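/- Let $N$ be a free abelian group of rank $n\ge 1$, let $M=\mathbb{Q}\otimes\operatorname{Hom}(N,\mathbb{Z})$, and let $\Sigma$ be a (finite, non-empty) fan of strongly convex rational polyhedral cones in $N_{\mathbb{Q}}$ with toric variety $X$. For $\sigma\in\Sigma$ write $\sigma^\perp\subseteq M$ for the space of functionals vanishing on $\sigma$, $N_\sigma$ for the subgroup of $N$ generated by $\sigma\cap N$, and $[V(\sigma)]$ for the invariant cycle of $\sigma$. A $\mathbb{Q}$-Cartier divisor $D$ on $X$ is given by local equations $m_\sigma\in M/\sigma^\perp$ $(\sigma\in\Sigma)$ such that $m_\sigma\mapsto m_\tau$ whenever $\tau$ is a face of $\sigma$. Let $0=L_0\subsetneq L_1\subsetneq\dots\subsetneq L_n=M$ be a complete flag of subspaces that is generic with respect to $\Sigma$: $\sigma^\perp\cap L_k=0$ for every $k$-dimensional $\sigma\in\Sigma$. Put $\Psi(\sigma)=L_{\dim\sigma}$, and let $\pi_\sigma:M=\sigma^\perp\oplus\Psi(\sigma)\to\sigma^\perp$ be the projection, as well as the map $M/\tau^\perp\to\sigma^\perp/\tau^\perp$ that it induces when $\sigma$ is a face of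 $\tau$. A $\mathbb{Q}$-Cartier divisor $D$ acts linearly on invariant cycles with rational coefficients by $$D\cdot[V(\sigma)]=\sum_{\tau}\langle\pi_\sigma(m_\tau),n_{\tau,\sigma}\rangle\,[V(\tau)],$$ where $\tau$ runs over the cones of $\Sigma$ having $\sigma$ as a facet, and $n_{\tau,\sigma}$ is the generator of the image of $\tau$ in $N/N_\sigma$, i.e. the first lattice point of that ray. Let $D^n=D\cdots D\cdot[X]$ ($n$ factors), where $[X]=[V(\{0\})]$. The lattice volume of the simplex with vertices $u_0,\dots,u_n\in M$ is $\frac1{n!}\left|\det\big(\langle u_i-u_0,b_j\rangle\big)_{1\le i,j\le n}\right|$ for any basis $b_1,\dots,b_n$ of $N$. Hyperplanes $H_0,\dots,H_n$ in $M$ determine the simplex with vertices $v_0,\dots,v_n$ if for each $i$ the hyperplanes other than $H_i$ meet in the single point $v_i$ (the simplex may be degenerate, and then has volume $0$). **Theorem.** Let $\sigma\in\Sigma$ be an $n$-dimensional simplicial cone, with extreme rays $\rho_1,\dots,\rho_n$ and facets $\tau_1,\dots,\tau_n$, where $\rho_i\not\subseteq\tau_i$. Let $D$ be a $\mathbb{Q}$-Cartier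 divisor with local equation $m\in M$ on $\sigma$. Let $\sigma^\vee\subseteq M$ be the dual cone, $\gamma^*=\gamma^\perp\cap\sigma^\vee$ for a face $\gamma$ of $\sigma$, and $H=m+L_{n-1}$ the hyperplane through $m$ parallel to $L_{n-1}$. Then the affine spans of $\rho_1^*,\dots,\rho_n^*$ together with $H$ determine a simplex $S$ in $M$, which is non-degenerate if $m\notin L_{n-1}$, and the coefficient of $[V(\sigma)]$ in $D^n$ is $$(-1)^{s}\,n!\,\operatorname{vol}(S),$$ where $\operatorname{vol}$ is the lattice volume and $s$ is the number of indices $i$ for which $H$ does not intersect $\tau_i^*$. -/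

import Mathlib

open scoped TensorProduct

noncomputable section

namespace Toric

/-! ### Lattices, cones and faces -/

section Cones

variable (N : Type*) [AddCommGroup N]

/-- The rational vector space `N_ℚ = ℚ ⊗ N` in which the cones of a fan live. -/
abbrev NQ : Type _ := ℚ ⊗[ℤ] N

/-- The rational vector space `M_ℚ = ℚ ⊗ Hom(N, ℤ)`, realised as the dual of `N_ℚ`. -/
abbrev MQ : Type _ := Module.Dual ℚ (NQ N)

/-- The inclusion of the lattice `N` in `N_ℚ`. -/
def latticeMap : N →ₗ[ℤ] NQ N := TensorProduct.mk ℤ ℚ N 1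

/-- Convex cones in `N_ℚ` (containing `0`). -/
abbrev Cone : Type _ := PointedCone ℚ (NQ N)

variable {N}

/-- The linear span of a cone. -/
def linearSpan (σ : Cone N) : Submodule ℚ (NQ N) := Submodule.span ℚ (σ : Set (NQ N))

/-- The dimension of a cone. -/
def dim (σ : Cone N) : ℕ := Module.finrank ℚ (linearSpan σ)

/-- `M(σ) = σ^⊥`, the subspace of `M_ℚ` of functionals vanishing on `σ`. -/
def perp (σ : Cone N) : Submodule ℚ (MQ N) := (linearSpan σ).dualAnnihilator

/-- The dual cone `σ^∨`, all functionals that are non-negative on `σ`. -/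
def dualCone (σ : Cone N) : PointedCone ℚ (MQ N) :=
  PointedCone.dual (Module.Dual.eval ℚ (NQ N)) (σ : Set (NQ N))

/-- The face `γ^* = γ^⊥ ∩ σ^∨` of the dual cone `σ^∨`. -/
def dualFace (σ γ : Cone N) : Set (MQ N) := (perp γ : Set (MQ N)) ∩ (dualCone σ : Set (MQ N))

/-- `γ` is a facet of `σ`, i.e. a maximal proper face. -/
def IsFacet (γ σ : Cone N) : Prop :=
  γ.IsFaceOf σ ∧ γ ≠ σ ∧ ∀ δ : Cone N, δ.IsFaceOf σ → δ ≠ σ → γ ≤ δ → δ = γ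

/-- `ρ` is an extreme ray of `σ`, i.e. a one-dimensional face. -/
def IsExtremeRay (ρ σ : Cone N) : Prop := ρ.IsFaceOf σ ∧ dim ρ = 1

lemma mem_perp {σ : Cone N} {m : MQ N} : m ∈ perp σ ↔ ∀ x ∈ σ, m x = 0 := by
  rw [perp, Submodule.mem_dualAnnihilator]
  constructor
  · intro h x hx
    exact h x (Submodule.subset_span hx)
  · intro h x hx
    have : linearSpan σ ≤ LinearMap.ker m := Submodule.span_le.2 fun y hy => h y hy
    exact this hx

lemma perp_anti {σ τ : Cone N} (h : σ ≤ τ) : perp τ ≤ perp σ := fun _ hm =>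
  mem_perp.2 fun x hx => mem_perp.1 hm x (h hx)

end Cones

/-! ### Fans -/

section Fans

variable (N : Type*) [AddCommGroup N]

/-- A fan in `N_ℚ`: a non-empty finite collection of strongly convex polyhedral cones, closed under
taking faces, in which any two cones meet in a common face.  (Over `ℚ` every finitely generated cone
is generated by lattice vectors, so that rationality is automatic.) -/
structure Fan where
  cones : Finset (Cone N)
  nonempty : cones.Nonempty
  polyhedral : ∀ σ ∈ cones, σ.FG
  stronglyConvex : ∀ σ ∈ cones, (σ : ConvexCone ℚ (NQ N)).Salient
  face_mem : ∀ σ ∈ cones, ∀ τ : Cone N, τ.IsFaceOf σ → τ ∈ cones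
  inter_face : ∀ σ ∈ cones, ∀ τ ∈ cones, (σ ⊓ τ).IsFaceOf σ ∧ (σ ⊓ τ).IsFaceOf τ

variable {N}

lemma Fan.bot_mem (Δ : Fan N) : (⊥ : Cone N) ∈ Δ.cones := by
  obtain ⟨σ, hσ⟩ := Δ.nonempty
  refine Δ.face_mem σ hσ ⊥ ⟨bot_le, ?_⟩
  intro x y a hx hy ha h
  rw [Submodule.mem_bot] at h ⊢
  by_contra hx0
  have hax : a • x ∈ σ := PointedCone.smul_mem σ ha.le hx
  refine Δ.stronglyConvex σ hσ (a • x) hax (smul_ne_zero ha.ne' hx0) ?_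
  rw [neg_eq_of_add_eq_zero_right h]
  exact hy

end Fans

/-! ### The lattices `N_σ` and `N(σ)_τ = N_τ / N_σ`, and the pairing with `M(σ)_τ = M(σ) / M(τ)` -/

section Lattices

variable {N : Type*} [AddCommGroup N]

/-- The monoid `σ ∩ N` of lattice points of a cone. -/
def latticePoints (σ : Cone N) : AddSubmonoid N :=
  σ.toAddSubmonoid.comap (latticeMap N).toAddMonoidHom

/-- `N_σ`, the subgroup of `N` generated by `σ ∩ N`. -/
def latticeSpan (σ : Cone N) : Submodule ℤ N := Submodule.span ℤ (latticePoints σ : Set N)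

/-- `N(σ)_τ = N_τ / N_σ`. -/
abbrev NRel (σ τ : Cone N) : Type _ :=
  latticeSpan τ ⧸ (latticeSpan σ).submoduleOf (latticeSpan τ)

/-- `M_τ = M / M(τ)` (tensored with `ℚ`). -/
abbrev MQuot (τ : Cone N) : Type _ := MQ N ⧸ perp τ

/-- `M(σ)_τ = M(σ) / M(τ)` (tensored with `ℚ`). -/
abbrev MRel (σ τ : Cone N) : Type _ := perp σ ⧸ (perp τ).submoduleOf (perp σ)

lemma perp_apply_latticeSpan {σ : Cone N} {m : MQ N} (hm : m ∈ perp σ) {x : N}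
    (hx : x ∈ latticeSpan σ) : m (latticeMap N x) = 0 := by
  have : latticeSpan σ ≤ LinearMap.ker ((m.restrictScalars ℤ).comp (latticeMap N)) :=
    Submodule.span_le.2 fun y hy => mem_perp.1 hm _ hy
  exact this hx

/-- The duality pairing `⟨·,·⟩` between `M(σ)_τ = M(σ)/M(τ)` and `N(σ)_τ = N_τ/N_σ`. -/
def pairing (σ τ : Cone N) : MRel σ τ →ₗ[ℚ] (NRel σ τ →ₗ[ℤ] ℚ) :=
  Submodule.liftQ _
    { toFun := fun m => Submodule.liftQ _
        (((m : MQ N).restrictScalars ℤ ∘ₗ latticeMap N) ∘ₗ (latticeSpan τ).subtype)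
        (fun _ hx => perp_apply_latticeSpan m.2 hx)
      map_add' := fun m m' => by ext x; rfl
      map_smul' := fun c m => by ext x; rfl }
    (fun m hm => by
      ext x
      exact perp_apply_latticeSpan (show (m : MQ N) ∈ perp τ from hm) x.2)

/-- `u` generates the image of `τ ∩ N` in `N_τ / N_σ`: this image is `{0, u, 2u, …}`. -/
def IsImageGenerator (σ τ : Cone N) (u : NRel σ τ) : Prop :=
  ((latticePoints τ).comap (latticeSpan τ).subtype.toAddMonoidHom).map
    ((latticeSpan σ).submoduleOf (latticeSpan τ)).mkQ.toAddMonoidHom = AddSubmonoid.multiples u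

/-- `n_{τ,σ}`, for `σ` a facet of `τ`: the generator of the one-dimensional image of `τ` in `N(σ)`,
i.e. the first lattice point of that ray.  (There is exactly one such element when `τ` is a strongly
convex polyhedral cone with facet `σ`; no other case is used.) -/
def normalGenerator (σ τ : Cone N) : NRel σ τ := Classical.epsilon (IsImageGenerator σ τ)

end Lattices

/-! ### Divisors, cycles and the action -/

section Action

variable {N : Type*} [AddCommGroup N] (Δ : Fan N)

/-- A `ℚ`-Cartier divisor on the toric variety of `Δ`, given by its local equations
`m_σ ∈ M_σ`, which have to agree on faces. -/
structure QCartierDivisor where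
  localEq : ∀ σ : Δ.cones, MQuot (σ : Cone N)
  compat : ∀ (σ τ : Δ.cones) (h : (τ : Cone N).IsFaceOf σ),
    Submodule.factor (perp_anti h.le) (localEq σ) = localEq τ

/-- Invariant cycles with rational coefficients: the `ℚ`-vector space with basis the
`[V(σ)]`, `σ ∈ Δ`. -/
abbrev Cycle : Type _ := Δ.cones →₀ ℚ

/-- The class `[V(σ)]`. -/
def orbitClosure (σ : Δ.cones) : Cycle Δ := Finsupp.single σ 1

/-- `[X] = [V({0})]`. -/
def fundamentalCycle : Cycle Δ := orbitClosure Δ ⟨⊥, Δ.bot_mem⟩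

/-- A choice of complements for `Δ`: for every cone a complement `Ψ(σ)` of `M(σ) = σ^⊥`, such that
`Ψ(τ) ≤ Ψ(σ)` whenever `τ` is a face of `σ`. -/
structure ChoiceOfComplements where
  Ψ : Δ.cones → Submodule ℚ (MQ N)
  isCompl : ∀ σ : Δ.cones, IsCompl (perp (σ : Cone N)) (Ψ σ)
  mono : ∀ σ τ : Δ.cones, (τ : Cone N).IsFaceOf σ → Ψ τ ≤ Ψ σ

variable {Δ}

namespace ChoiceOfComplements

variable (C : ChoiceOfComplements Δ)

/-- The projection `π_σ : M → M(σ)` along `Ψ(σ)`. -/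
def proj (σ : Δ.cones) : MQ N →ₗ[ℚ] perp (σ : Cone N) :=
  Submodule.projectionOnto _ _ (C.isCompl σ)

/-- The map `π_σ : M_τ → M(σ)_τ` induced by the projection `π_σ : M → M(σ)`, for `σ ≤ τ`. -/
def projRel (σ τ : Δ.cones) (h : (σ : Cone N) ≤ τ) :
    MQuot (τ : Cone N) →ₗ[ℚ] MRel (σ : Cone N) (τ : Cone N) :=
  Submodule.mapQ _ _ (C.proj σ) (by
    intro m hm
    have h1 : C.proj σ m = ⟨m, perp_anti h hm⟩ :=
      Submodule.projectionOnto_apply_of_mem_left (C.isCompl σ) (perp_anti h hm)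
    change ((C.proj σ m : perp (σ : Cone N)) : MQ N) ∈ perp (τ : Cone N)
    rw [h1]
    exact hm)

/-- `⟨π_σ(m_τ), n_{τ,σ}⟩`, the coefficient of `[V(τ)]` in `D · [V(σ)]`, for `σ` a facet of `τ`. -/
def coeff (D : QCartierDivisor Δ) (σ τ : Δ.cones) (h : IsFacet (σ : Cone N) τ) : ℚ :=
  pairing (σ : Cone N) τ (C.projRel σ τ h.1.le (D.localEq τ)) (normalGenerator (σ : Cone N) τ)

open Classical in
/-- The action of a `ℚ`-Cartier divisor on cycles: the linear extension of
`D · [V(σ)] = ∑ ⟨π_σ(m_τ), n_{τ,σ}⟩ [V(τ)]`, the sum over all `τ ∈ Δ` with facet `σ`. -/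
def act (D : QCartierDivisor Δ) : Module.End ℚ (Cycle Δ) :=
  Finsupp.linearCombination ℚ fun σ : Δ.cones =>
    ∑ τ : Δ.cones, if h : IsFacet (σ : Cone N) τ then C.coeff D σ τ h • orbitClosure Δ τ else 0

/-- `D^k = D · ⋯ · D · [X]`. -/
def divisorPow (D : QCartierDivisor Δ) (k : ℕ) : Cycle Δ :=
  (C.act D ^ k) (fundamentalCycle Δ)

end ChoiceOfComplements

end Action

/-! ### Generic flags -/

section Flags

variable (N : Type*) [AddCommGroup N]

/-- A complete flag `0 = L_0 < L_1 < ⋯ < L_n = M` in `M_ℚ`, `n` the rank of `N` (the values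
`L_k` with `k > n` play no role). -/
structure CompleteFlag where
  L : ℕ → Submodule ℚ (MQ N)
  zero : L 0 = ⊥
  top : L (Module.finrank ℤ N) = ⊤
  lt_succ : ∀ k < Module.finrank ℤ N, L k < L (k + 1)

variable {N}

/-- The flag is generic with respect to `Δ`: `σ^⊥ ∩ L_k = 0` for all `k`-dimensional `σ ∈ Δ`. -/
def CompleteFlag.IsGeneric (𝓛 : CompleteFlag N) (Δ : Fan N) : Prop :=
  ∀ σ ∈ Δ.cones, perp σ ⊓ 𝓛.L (dim σ) = ⊥

lemma CompleteFlag.mono (𝓛 : CompleteFlag N) {i j : ℕ} (hij : i ≤ j)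
    (hj : j ≤ Module.finrank ℤ N) : 𝓛.L i ≤ 𝓛.L j := by
  induction j, hij using Nat.le_induction with
  | base => exact le_rfl
  | succ j _ ih => exact (ih (by omega)).trans (𝓛.lt_succ j (by omega)).le

variable [Module.Finite ℤ N]

lemma dim_mono {σ τ : Cone N} (h : σ ≤ τ) : dim σ ≤ dim τ :=
  Submodule.finrank_mono (Submodule.span_mono h)

lemma CompleteFlag.le_finrank (𝓛 : CompleteFlag N) {k : ℕ} (hk : k ≤ Module.finrank ℤ N) :
    k ≤ Module.finrank ℚ (𝓛.L k) := by
  induction k with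
  | zero => exact Nat.zero_le _
  | succ k ih =>
    have h1 := ih (by omega)
    have h2 := Submodule.finrank_lt_finrank_of_lt (𝓛.lt_succ k (by omega))
    omega

variable [Module.Free ℤ N]

lemma dim_le (σ : Cone N) : dim σ ≤ Module.finrank ℤ N := by
  have h : Module.finrank ℚ (NQ N) = Module.finrank ℤ N := Module.finrank_baseChange
  rw [← h]
  exact Submodule.finrank_le _

/-- The choice of complements `Ψ(σ) = L_k`, `k = dim σ`, of a generic flag. -/
def CompleteFlag.complements (𝓛 : CompleteFlag N) {Δ : Fan N} (h : 𝓛.IsGeneric Δ) :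
    ChoiceOfComplements Δ where
  Ψ σ := 𝓛.L (dim (σ : Cone N))
  isCompl σ := by
    have hd : Disjoint (perp (σ : Cone N)) (𝓛.L (dim (σ : Cone N))) :=
      disjoint_iff.2 (h σ σ.2)
    refine ⟨hd, codisjoint_iff.2 (Submodule.eq_top_of_finrank_eq ?_)⟩
    have h1 := Submodule.finrank_sup_add_finrank_inf_eq (perp (σ : Cone N))
      (𝓛.L (dim (σ : Cone N)))
    rw [h σ σ.2, finrank_bot] at h1
    have h2 : dim (σ : Cone N) + Module.finrank ℚ (perp (σ : Cone N)) =
        Module.finrank ℚ (NQ N) :=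
      Subspace.finrank_add_finrank_dualAnnihilator_eq (linearSpan (σ : Cone N))
    have h3 : Module.finrank ℚ (MQ N) = Module.finrank ℚ (NQ N) := Subspace.dual_finrank_eq
    have h4 := 𝓛.le_finrank (dim_le (σ : Cone N))
    have h5 := Submodule.finrank_le (perp (σ : Cone N) ⊔ 𝓛.L (dim (σ : Cone N)))
    omega
  mono σ _ hτ := 𝓛.mono (dim_mono hτ.le) (dim_le (σ : Cone N))

end Flags

/-! ### Simplices and lattice volume -/

section Volume

variable {N : Type*} [AddCommGroup N] [Module.Free ℤ N] [Module.Finite ℤ N]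

/-- The lattice volume of the simplex with vertices `u_0, …, u_n` in `M_ℚ`:
`1/n!` times the absolute value of the determinant of the matrix `⟨u_{i+1} - u_0, b_j⟩`, where the
`b_j` are a basis of `N`; the next lemma says that any basis may be used. -/
def latticeVolume (u : Fin (Module.finrank ℤ N + 1) → MQ N) : ℚ :=
  1 / ((Module.finrank ℤ N).factorial : ℚ) *
    |(Matrix.of fun i j : Fin (Module.finrank ℤ N) =>
      (u i.succ - u 0) (latticeMap N (Module.finBasis ℤ N j))).det|

lemma latticeVolume_eq (b : Module.Basis (Fin (Module.finrank ℤ N)) ℤ N)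
    (u : Fin (Module.finrank ℤ N + 1) → MQ N) :
    latticeVolume u = 1 / ((Module.finrank ℤ N).factorial : ℚ) *
      |(Matrix.of fun i j : Fin (Module.finrank ℤ N) =>
        (u i.succ - u 0) (latticeMap N (b j))).det| := by
  set c := Module.finBasis ℤ N with hc
  have key : (Matrix.of fun i j : Fin (Module.finrank ℤ N) =>
        (u i.succ - u 0) (latticeMap N (c j))) =
      (Matrix.of fun i j : Fin (Module.finrank ℤ N) =>
        (u i.succ - u 0) (latticeMap N (b j))) * (b.toMatrix c).map (Int.castRingHom ℚ) := by
    ext i j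
    rw [Matrix.mul_apply, Matrix.of_apply]
    conv_lhs => rw [← b.sum_toMatrix_smul_self (c : _ → N) j]
    rw [map_sum, map_sum]
    refine Finset.sum_congr rfl fun k _ => ?_
    simp only [map_smul, LinearMap.map_smul_of_tower, Matrix.of_apply, Matrix.map_apply, zsmul_eq_mul, eq_intCast]
    exact mul_comm _ _
  have hdet : |((b.toMatrix c).map (Int.castRingHom ℚ)).det| = 1 := by
    have h1 : IsUnit (b.toMatrix c).det := by
      rw [← Module.Basis.det_apply]
      exact b.isUnit_det c
    have h2 := Int.isUnit_iff_abs_eq.1 h1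
    have h3 : ((b.toMatrix c).map (Int.castRingHom ℚ)).det = ((b.toMatrix c).det : ℚ) := by
      rw [← RingHom.mapMatrix_apply, ← RingHom.map_det]; rfl
    rw [h3, ← Int.cast_abs, h2, Int.cast_one]
  rw [latticeVolume, key, Matrix.det_mul, abs_mul, hdet, mul_one]

/-- `v_0, …, v_n` are the vertices of the simplex determined by the hyperplanes `H_0, …, H_n`:
`v_i` is the one point in which all hyperplanes other than `H_i` meet. -/
def IsSimplexOf {n : ℕ} (H : Fin (n + 1) → AffineSubspace ℚ (MQ N))
    (v : Fin (n + 1) → MQ N) : Prop :=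
  ∀ i, (⋂ j : {j // j ≠ i}, (H j : Set (MQ N))) = {v i}

end Volume

end Toric

end

/-! Pick lattice vectors `b i` on the rays of σ; they form a basis of `NQ N`, and the faces of σ are
the cones σ_J spanned by the `b j`, j ∈ J. Let c_J be the coefficient of [V(σ_J)] in D^|J|, and E_J
the product of c_J with the index of the lattice generated by these `b j` in N_{σ_J}. The indices
absorb the normal generators (`multiplicity_mul_coeff`), so the action of D becomes E_J = ∑_{i ∈ J}
E_{J∖i} · π_{J∖i}(m)(b i).

Dualise the flag: let G_k ⊆ `NQ N` be the annihilator of L_k. Genericity says that span σ_J meets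
G_|J| only in 0, and a dimension count gives a nonzero v in span σ_J ∩ G_{|J|-1}; all its
coordinates v_j, j ∈ J, are nonzero. Now m - π_{J∖i}(m) lies in L_{|J|-1} and kills v, while
π_{J∖i}(m) sees only the i-th coordinate of v, so π_{J∖i}(m)(b i) = m(v)/v_i
(`CompleteFlag.proj_complements_apply_mul`). By induction E_J · ∏ v_j = m(v)^|J| (`flag_recursion`):
the vectors belonging to the facets of σ_J lie in a pencil w - r_i v, and the sum over facets
collapses by Lagrange interpolation.

For J everything, v = l is an equation of L_{n-1}, so H is {f | f(l) = m(l)}. The vertices of S are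
0 and (m(l)/l_i) times the dual basis vectors. Hence ∏ m(l)/l_i is, up to sign, n! vol(S) times the
index of the lattice of the `b i` in N; the index cancels. A factor is negative exactly when H
misses the ray τ_i^*, which gives the sign. -/

/-! ### Interpolation and the recursion along a flag. -/

-- Compare leading coefficients: (B X - A)^k has degree at most k, so its coefficient at X^k is
-- determined by its values at the k + 1 nodes `r i`. Reversing the signs in numerator and
-- denominator costs (-1)^k twice.
open Polynomial in
theorem Lagrange.sum_linear_pow_div_prod {ι F : Type*} [DecidableEq ι] [Field F] {s : Finset ι}
    {r : ι → F} (hr : Set.InjOn r s) {k : ℕ} (hs : s.card = k + 1) (A B : F) :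
    ∑ i ∈ s, (A - r i * B) ^ k / ∏ j ∈ s.erase i, (r j - r i) = B ^ k := by
  have hdeg : (C B * X + C (-A)).natDegree ≤ 1 := natDegree_linear_le
  have hd : ((C B * X + C (-A)) ^ k).natDegree ≤ k :=
    (natDegree_pow_le_of_le k hdeg).trans (by simp)
  have hlt : ((C B * X + C (-A)) ^ k).degree < (s.card : WithBot ℕ) :=
    (degree_le_of_natDegree_le hd).trans_lt (by rw [hs]; exact_mod_cast Nat.lt_succ_self k)
  have h := Lagrange.coeff_eq_sum hr hlt
  have hc : ((C B * X + C (-A)) ^ k).coeff k = B ^ k := by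
    have := coeff_pow_of_natDegree_le (m := k) hdeg
    simpa using this
  rw [hs, Nat.add_sub_cancel, hc] at h
  rw [h]
  refine Finset.sum_congr rfl fun i hi => ?_
  have h1 : ∏ j ∈ s.erase i, (r j - r i) = (-1) ^ k * ∏ j ∈ s.erase i, (r i - r j) := by
    rw [show k = (s.erase i).card by rw [Finset.card_erase_of_mem hi, hs]; rfl,
      ← Finset.prod_const, ← Finset.prod_mul_distrib]
    exact Finset.prod_congr rfl fun j _ => by ring
  have h2 : (A - r i * B) ^ k = (-1) ^ k * (B * r i - A) ^ k := by
    rw [← mul_pow]; congr 1; ring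
  rw [h1, h2, mul_div_mul_left _ _ (pow_ne_zero _ (by simp))]
  simp [sub_eq_add_neg]

/-- If the coordinate at j vanished, v would be supported on the |J| - 1 indices of `J.erase j`
while lying in `G (J.card - 1)`, against general position. -/
theorem repr_ne_zero_of_disjoint_flag {ι V : Type*} [DecidableEq ι] [AddCommGroup V] [Module ℚ V]
    (b : Module.Basis ι ℚ V) (G : ℕ → Submodule ℚ V)
    (hdisj : ∀ (J : Finset ι), ∀ v ∈ G J.card, (∀ j ∉ J, b.repr v j = 0) → v = 0)
    {J : Finset ι} {v : V} (hv : v ∈ G (J.card - 1)) (hv0 : v ≠ 0)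
    (hsupp : ∀ j ∉ J, b.repr v j = 0) : ∀ j ∈ J, b.repr v j ≠ 0 := by
  intro j hj h0
  refine hv0 (hdisj (J.erase j) v (by rwa [Finset.card_erase_of_mem hj]) fun i hi => ?_)
  by_cases hij : i = j
  · rw [hij, h0]
  · exact hsupp i fun hiJ => hi (Finset.mem_erase.2 ⟨hij, hiJ⟩)

/-- A recursion over the finite subsets of a basis whose solution is governed by a flag `G` in
general position with respect to the coordinate subspaces. -/
theorem flag_recursion {ι V : Type*} [DecidableEq ι] [AddCommGroup V] [Module ℚ V]
    (b : Module.Basis ι ℚ V) (G : ℕ → Submodule ℚ V)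
    (hG : ∀ J : Finset ι, ∀ k < J.card, G (k + 1) ≤ G k)
    (hdisj : ∀ (J : Finset ι), ∀ v ∈ G J.card, (∀ j ∉ J, b.repr v j = 0) → v = 0)
    (hex : ∀ J : Finset ι, J.Nonempty →
      ∃ v ∈ G (J.card - 1), v ≠ 0 ∧ ∀ j ∉ J, b.repr v j = 0)
    (m : Module.Dual ℚ V) (E : Finset ι → ℚ) (p : Finset ι → ι → ℚ) (hE0 : E ∅ = 1)
    (hE : ∀ J : Finset ι, J.Nonempty → E J = ∑ i ∈ J, E (J.erase i) * p (J.erase i) i)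
    (hp : ∀ (I : Finset ι) (i : ι), i ∉ I → ∀ v ∈ G I.card,
      (∀ j ∉ insert i I, b.repr v j = 0) → p I i * b.repr v i = m v) :
    ∀ J : Finset ι, J.Nonempty → ∀ v ∈ G (J.card - 1), v ≠ 0 → (∀ j ∉ J, b.repr v j = 0) →
      E J * ∏ j ∈ J, b.repr v j = m v ^ J.card := by
  intro J
  induction J using Finset.strongInduction with
  | H J ih =>
  intro hJ v hv hv0 hsupp
  have hcoord := repr_ne_zero_of_disjoint_flag b G hdisj hv hv0 hsupp
  have hpJ : ∀ i ∈ J, p (J.erase i) i = m v / b.repr v i := by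
    intro i hi
    rw [eq_div_iff (hcoord i hi)]
    refine hp _ i (Finset.notMem_erase i J) v (by rwa [Finset.card_erase_of_mem hi]) ?_
    rwa [Finset.insert_erase hi]
  rw [hE J hJ, Finset.sum_mul]
  obtain ⟨i₀, hi₀⟩ := hJ
  -- Singletons are separate: erasing leaves ∅, which the inductive claim excludes, and `hE0` takes
  -- its place.
  rcases Nat.eq_or_lt_of_le (Finset.card_pos.2 ⟨i₀, hi₀⟩ : 1 ≤ J.card) with h1 | h2
  · have hJi : J = {i₀} := Finset.eq_singleton_iff_unique_mem.2
      ⟨hi₀, fun j hj => Finset.card_le_one.1 h1.symm.le j hj i₀ hi₀⟩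
    have h3 := hpJ i₀ hi₀
    have h4 := hcoord i₀ hi₀
    subst hJi
    simp only [Finset.erase_singleton] at h3
    simp [hE0, h3, h4]
  obtain ⟨k, hk⟩ : ∃ k, J.card = k + 2 := ⟨J.card - 2, by omega⟩
  have hcard : ∀ i ∈ J, (J.erase i).card = k + 1 := fun i hi => by
    rw [Finset.card_erase_of_mem hi, hk]; rfl
  have hnonempty : ∀ i ∈ J, (J.erase i).Nonempty := fun i hi =>
    Finset.card_pos.1 (by rw [hcard i hi]; omega)
  rw [hk, show k + 2 - 1 = k + 1 by omega] at hv
  have hvk : v ∈ G k := hG J k (by omega) hv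
  obtain ⟨w, hw, hw0, hwsupp⟩ := hex (J.erase i₀) (hnonempty i₀ hi₀)
  rw [hcard i₀ hi₀, Nat.add_sub_cancel] at hw
  -- With this ratio, the i-th coordinate of `w - r i • v` vanishes, so this is the vector to which
  -- induction applies for `J.erase i`.
  set r : ι → ℚ := fun j => b.repr w j / b.repr v j with hr
  have hwr : ∀ j ∈ J, b.repr w j = r j * b.repr v j := fun j hj => by
    rw [hr]; exact (div_mul_cancel₀ _ (hcoord j hj)).symm
  have hwJ : ∀ j ∉ J, b.repr w j = 0 := fun j hj =>
    hwsupp j fun h => hj (Finset.mem_of_mem_erase h)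
  have hu : ∀ i, ∀ j ∈ J, b.repr (w - r i • v) j = b.repr v j * (r j - r i) := by
    intro i j hj
    simp only [map_sub, map_smul, Finsupp.sub_apply, Finsupp.smul_apply, smul_eq_mul, hwr j hj]
    ring
  have hu' : ∀ i, ∀ j ∉ J, b.repr (w - r i • v) j = 0 := by
    intro i j hj
    simp [hwJ j hj, hsupp j hj]
  have huG : ∀ i, w - r i • v ∈ G k := fun i => sub_mem hw ((G k).smul_mem _ hvk)
  -- A coincidence `r i = r j` makes `w - r i • v` vanish at two indices, leaving k of them; as it
  -- lies in `G k` it is 0. Its coordinate at `i₀`, where w vanishes, then forces `r i = 0` and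
  -- hence w = 0.
  have hinj : Set.InjOn r J := by
    intro i hi j hj hij
    by_contra hne'
    have hz : w - r i • v = 0 := by
      refine hdisj ((J.erase i).erase j) _ ?_ fun l hl => ?_
      · rw [Finset.card_erase_of_mem (Finset.mem_erase.2 ⟨Ne.symm hne', hj⟩), hcard i hi]
        exact huG i
      · by_cases hlJ : l ∈ J
        · rw [hu i l hlJ]
          have : l = j ∨ l = i := by
            by_contra hcon
            push Not at hcon
            exact hl (Finset.mem_erase.2 ⟨hcon.1, Finset.mem_erase.2 ⟨hcon.2, hlJ⟩⟩)
          rcases this with rfl | rfl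
          · rw [hij, sub_self, mul_zero]
          · rw [sub_self, mul_zero]
        · exact hu' i l hlJ
    have h5 : r i₀ = 0 := by
      simp [hr, hwsupp i₀ (Finset.notMem_erase i₀ J)]
    have h6 := hu i i₀ hi₀
    rw [hz, h5] at h6
    have h7 : r i = 0 := by simpa [hcoord i₀ hi₀] using h6
    rw [h7, zero_smul, sub_zero] at hz
    exact hw0 hz
  -- Induction at `w - r i • v`, whose coordinates are v_j (r_j - r_i), evaluates the factor `E
  -- (J.erase i)`; the remaining p · v_i equals m(v).
  have hterm : ∀ i ∈ J, E (J.erase i) * p (J.erase i) i * ∏ j ∈ J, b.repr v j =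
      m v * ((m w - r i * m v) ^ (k + 1) / ∏ j ∈ J.erase i, (r j - r i)) := by
    intro i hi
    have hne0 : w - r i • v ≠ 0 := by
      obtain ⟨j, hj⟩ := hnonempty i hi
      rw [Finset.mem_erase] at hj
      intro h0
      have h8 := hu i j hj.2
      rw [h0, map_zero, Finsupp.zero_apply, eq_comm, mul_eq_zero, sub_eq_zero] at h8
      exact h8.elim (hcoord j hj.2) fun h => hj.1 (hinj hj.2 hi h)
    have hih := ih (J.erase i) (Finset.erase_ssubset hi) (hnonempty i hi) (w - r i • v)
      (by rw [hcard i hi]; exact huG i) hne0 (fun j hj => by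
        by_cases hjJ : j ∈ J
        · have : j = i := by
            by_contra hji
            exact hj (Finset.mem_erase.2 ⟨hji, hjJ⟩)
          rw [hu i j hjJ, this, sub_self, mul_zero]
        · exact hu' i j hjJ)
    rw [hcard i hi, Finset.prod_congr rfl fun j hj => hu i j (Finset.mem_of_mem_erase hj),
      Finset.prod_mul_distrib, map_sub, map_smul, smul_eq_mul] at hih
    have hprod : ∏ j ∈ J.erase i, (r j - r i) ≠ 0 := Finset.prod_ne_zero_iff.2 fun j hj =>
      sub_ne_zero.2 fun h => (Finset.mem_erase.1 hj).1
        (hinj (Finset.mem_of_mem_erase hj) hi h)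
    have hci := hcoord i hi
    rw [← hih, ← Finset.mul_prod_erase J _ hi, hpJ i hi]
    field_simp
  rw [Finset.sum_congr rfl hterm, ← Finset.mul_sum,
    Lagrange.sum_linear_pow_div_prod hinj hk, hk, pow_succ']
  ring

/-! ### Indices of subgroups extended by one generator. -/

namespace AddSubgroup

variable {G : Type*} [AddCommGroup G]

theorem relIndex_sup_zmultiples_nsmul (B : AddSubgroup G) {y : G} (a : ℕ)
    (hy : ∀ k : ℤ, k • y ∈ B → k = 0) :
    (B ⊔ zmultiples (a • y)).relIndex (B ⊔ zmultiples y) = a := by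
  have h1 : zmultiples (a • y) ≤ zmultiples y := by
    rw [zmultiples_le]; exact nsmul_mem (mem_zmultiples y) a
  have h2 : B ⊔ zmultiples y = (B ⊔ zmultiples (a • y)) ⊔ zmultiples y := by
    rw [sup_assoc, sup_eq_right.2 h1]
  have h3 : zmultiples y = (⊤ : AddSubgroup ℤ).map (zmultiplesHom G y) := by
    rw [← AddMonoidHom.range_eq_map]; rfl
  have h4 : (B ⊔ zmultiples (a • y)).comap (zmultiplesHom G y) = zmultiples (a : ℤ) := by
    ext k
    simp only [mem_comap, zmultiplesHom_apply, mem_sup, mem_zmultiples_iff]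
    constructor
    · rintro ⟨z, hz, -, ⟨l, rfl⟩, h⟩
      refine ⟨l, ?_⟩
      have : (k - l * a) • y ∈ B := by
        rw [sub_smul, mul_smul, natCast_zsmul, ← h, add_sub_cancel_right]
        exact hz
      have := hy _ this
      rw [smul_eq_mul]; omega
    · rintro ⟨l, rfl⟩
      exact ⟨0, B.zero_mem, _, ⟨l, rfl⟩, by
        rw [zero_add, smul_eq_mul, mul_smul, natCast_zsmul]⟩
  rw [h2, relIndex_sup_left, h3, ← relIndex_comap, h4, relIndex_top_right,
    Int.index_zmultiples, Int.natAbs_natCast]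

/-- Interpolate B + ℤx = B + ℤ(ay). Since y has infinite order modulo B and a ≠ 0, A + ℤx meets B in
A, so the lower step has index [B : A]; the upper step has index a. -/
theorem relIndex_sup_zmultiples {A B : AddSubgroup G} (hAB : A ≤ B) {x y : G} {a : ℕ}
    (ha : a ≠ 0) (hxy : x - a • y ∈ B) (hy : ∀ k : ℤ, k • y ∈ B → k = 0) :
    (A ⊔ zmultiples x).relIndex (B ⊔ zmultiples y) = a * A.relIndex B := by
  have h1 : B ⊔ zmultiples x = B ⊔ zmultiples (a • y) := by
    refine le_antisymm (sup_le le_sup_left ?_) (sup_le le_sup_left ?_) <;> rw [zmultiples_le]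
    · rw [← sub_add_cancel x (a • y)]
      exact add_mem (mem_sup_left hxy) (mem_sup_right (mem_zmultiples _))
    · rw [← sub_sub_cancel x (a • y)]
      exact sub_mem (mem_sup_right (mem_zmultiples _)) (mem_sup_left hxy)
  have h2 : (A ⊔ zmultiples x) ⊓ B = A := by
    refine le_antisymm (fun z hz => ?_) (le_inf le_sup_left hAB)
    obtain ⟨hz, hzB⟩ := mem_inf.1 hz
    obtain ⟨u, hu, -, ⟨k, rfl⟩, rfl⟩ := mem_sup.1 hz
    have h3 : k • x ∈ B := by simpa using sub_mem hzB (hAB hu)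
    have h4 : (k * a) • y ∈ B := by
      have := sub_mem h3 (zsmul_mem hxy k)
      rwa [smul_sub, sub_sub_cancel, ← natCast_zsmul, ← mul_smul] at this
    have h5 : k = 0 := by simpa [ha] using hy _ h4
    simpa [h5] using hu
  have h6 : B ⊔ zmultiples x = (A ⊔ zmultiples x) ⊔ B := by
    rw [sup_right_comm, sup_eq_right.2 hAB]
  have h7 : (A ⊔ zmultiples x).relIndex (B ⊔ zmultiples x) = A.relIndex B := by
    rw [h6, relIndex_sup_left, ← inf_relIndex_right, h2]
  rw [← relIndex_mul_relIndex (A ⊔ zmultiples x) (B ⊔ zmultiples x) (B ⊔ zmultiples y)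
    (sup_le_sup_right hAB _), h7, h1, relIndex_sup_zmultiples_nsmul B a hy, mul_comm]
  rw [h1]
  refine sup_le_sup_left ?_ _
  rw [zmultiples_le]; exact nsmul_mem (mem_zmultiples y) a

end AddSubgroup

/-! ### Simplicial cones in coordinates and their faces. -/

namespace PointedCone

variable {ι V : Type*} [AddCommGroup V] [Module ℚ V]

/-- The cone generated by the vectors `b j`, `j ∈ J`, of a basis `b`. -/
def orthant (b : Module.Basis ι ℚ V) (J : Finset ι) : PointedCone ℚ V where
  carrier := {v | (∀ j, 0 ≤ b.repr v j) ∧ ∀ j ∉ J, b.repr v j = 0}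
  add_mem' {v w} hv hw := ⟨fun j => by simpa using add_nonneg (hv.1 j) (hw.1 j),
    fun j hj => by simp [hv.2 j hj, hw.2 j hj]⟩
  zero_mem' := by simp
  smul_mem' c v hv := by
    have hc : ∀ j, b.repr (c • v) j = (c : ℚ) * b.repr v j := fun j =>
      DFunLike.congr_fun (b.repr.map_smul (c : ℚ) v) j
    exact ⟨fun j => (hc j).symm ▸ mul_nonneg c.2 (hv.1 j),
      fun j hj => by rw [hc, hv.2 j hj, mul_zero]⟩

variable {b : Module.Basis ι ℚ V} {I J : Finset ι}

theorem mem_orthant {v : V} :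
    v ∈ orthant b J ↔ (∀ j, 0 ≤ b.repr v j) ∧ ∀ j ∉ J, b.repr v j = 0 := Iff.rfl

theorem basis_mem_orthant {i : ι} : b i ∈ orthant b J ↔ i ∈ J := by
  classical
  rw [mem_orthant]
  constructor
  · rintro ⟨-, h⟩
    by_contra hi
    simpa using h i hi
  · refine fun hi => ⟨fun j => ?_, fun j hj => ?_⟩ <;>
      rw [Module.Basis.repr_self, Finsupp.single_apply]
    · split_ifs <;> norm_num
    · rw [if_neg]; rintro rfl; exact hj hi

theorem orthant_le_orthant : orthant b I ≤ orthant b J ↔ I ⊆ J :=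
  ⟨fun h _ hi => basis_mem_orthant.1 (h (basis_mem_orthant.2 hi)),
    fun h _ hv => ⟨hv.1, fun j hj => hv.2 j fun hi => hj (h hi)⟩⟩

theorem orthant_injective : Function.Injective (orthant b) := fun _ _ h =>
  (orthant_le_orthant.1 h.le).antisymm (orthant_le_orthant.1 h.ge)

theorem orthant_empty : orthant b ∅ = ⊥ := by
  ext v
  rw [mem_orthant, Submodule.mem_bot]
  constructor
  · rintro ⟨-, h⟩
    exact b.repr.map_eq_zero_iff.1 (Finsupp.ext fun j => h j (Finset.notMem_empty j))
  · rintro rfl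
    simp

theorem orthant_isFaceOf_orthant (h : I ⊆ J) : (orthant b I).IsFaceOf (orthant b J) := by
  refine ⟨orthant_le_orthant.2 h, fun {x y a} hx hy ha hxy => ⟨hx.1, fun j hj => ?_⟩⟩
  have h1 := hxy.2 j hj
  simp only [map_add, map_smul, Finsupp.add_apply, Finsupp.smul_apply, smul_eq_mul] at h1
  have h2 := (add_eq_zero_iff_of_nonneg (mul_nonneg ha.le (hx.1 j)) (hy.1 j)).1 h1
  exact (mul_eq_zero.1 h2.1).resolve_left ha.ne'

variable [Fintype ι]

theorem orthant_univ : orthant b Finset.univ = hull ℚ (Set.range b) := by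
  refine le_antisymm (fun v hv => ?_) (Submodule.span_le.2 ?_)
  · rw [← b.sum_repr v]
    exact sum_mem fun i _ => smul_mem _ (hv.1 i) (subset_hull ⟨i, rfl⟩)
  · rintro _ ⟨i, rfl⟩
    exact basis_mem_orthant.2 (Finset.mem_univ i)

/-- A face is generated by the basis vectors it contains: if v ∈ F has a positive coordinate at j,
subtracting that component stays in the cone, so the face property puts `b j` in F. -/
theorem IsFaceOf.eq_orthant {F : PointedCone ℚ V} (h : F.IsFaceOf (orthant b J)) :
    ∃ I ⊆ J, F = orthant b I := by
  classical
  refine ⟨Finset.univ.filter fun i => i ∈ J ∧ b i ∈ F, fun i hi => (Finset.mem_filter.1 hi).2.1,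
    le_antisymm (fun v hv => ?_) fun v hv => ?_⟩
  · have hvJ := h.le hv
    refine ⟨hvJ.1, fun j hj => ?_⟩
    by_cases hjJ : j ∈ J
    · by_contra h0
      have hpos := lt_of_le_of_ne (hvJ.1 j) (Ne.symm h0)
      have hbj : b j ∈ F := by
        refine h.mem_of_smul_add_mem (basis_mem_orthant.2 hjJ) (y := v - b.repr v j • b j)
          ?_ hpos (by rwa [add_sub_cancel])
        refine ⟨fun i => ?_, fun i hi => ?_⟩ <;>
          simp only [map_sub, map_smul, Finsupp.sub_apply, Finsupp.smul_apply,
            Module.Basis.repr_self, Finsupp.single_apply, smul_eq_mul]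
        · split_ifs with hij
          · simp [hij]
          · simpa using hvJ.1 i
        · rw [hvJ.2 i hi, if_neg]
          · simp
          · rintro rfl; exact hi hjJ
      exact hj (by simp [hjJ, hbj])
    · exact hvJ.2 j hjJ
  · rw [← b.sum_repr v]
    refine sum_mem fun i _ => ?_
    by_cases hi : b i ∈ F
    · exact smul_mem _ (hv.1 i) hi
    · rw [hv.2 i (by simp [hi]), zero_smul]
      exact zero_mem _

theorem span_orthant : Submodule.span ℚ (orthant b J : Set V) = Submodule.span ℚ (b '' J) := by
  refine le_antisymm (Submodule.span_le.2 fun v hv => ?_) (Submodule.span_mono ?_)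
  · rw [SetLike.mem_coe, ← b.sum_repr v]
    refine sum_mem fun i _ => ?_
    by_cases hi : i ∈ J
    · exact Submodule.smul_mem _ _ (Submodule.subset_span ⟨i, hi, rfl⟩)
    · rw [hv.2 i hi, zero_smul]
      exact zero_mem _
  · rintro _ ⟨i, hi, rfl⟩
    exact basis_mem_orthant.2 hi

theorem finrank_span_orthant :
    Module.finrank ℚ (Submodule.span ℚ (orthant b J : Set V)) = J.card := by
  classical
  rw [span_orthant, ← Finset.coe_image, finrank_span_finset_eq_card,
    Finset.card_image_of_injective _ b.injective]
  have := (b.linearIndependent.linearIndepOn_id).mono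
    (t := ((J.image b : Finset V) : Set V)) (by
      rw [Finset.coe_image]; exact Set.image_subset_range _ _)
  exact this

theorem mem_span_orthant {v : V} :
    v ∈ Submodule.span ℚ (orthant b J : Set V) ↔ ∀ j ∉ J, b.repr v j = 0 := by
  rw [span_orthant, b.mem_span_image]
  constructor
  · intro h j hj
    by_contra h0
    exact hj (h (Finsupp.mem_support_iff.2 h0))
  · intro h j hj
    by_contra h0
    exact Finsupp.mem_support_iff.1 hj (h j h0)

end PointedCone

/-! ### Perpendicular spaces, dual cones, facets and rays of these cones. -/

namespace Toric
open PointedCone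

variable {ι N : Type*} [AddCommGroup N] [Fintype ι] {b : Module.Basis ι ℚ (NQ N)} {J : Finset ι}

theorem dim_orthant : dim (orthant b J) = J.card := finrank_span_orthant

theorem mem_perp_orthant {f : MQ N} : f ∈ perp (orthant b J) ↔ ∀ j ∈ J, f (b j) = 0 := by
  refine ⟨fun h j hj => mem_perp.1 h _ (basis_mem_orthant.2 hj), fun h => mem_perp.2 fun v hv => ?_⟩
  rw [← b.sum_repr v, map_sum]
  refine Finset.sum_eq_zero fun i _ => ?_
  by_cases hi : i ∈ J
  · rw [map_smul, h i hi, smul_zero]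
  · rw [hv.2 i hi, zero_smul, map_zero]

theorem mem_dualCone_orthant {f : MQ N} :
    f ∈ dualCone (orthant b J) ↔ ∀ j ∈ J, 0 ≤ f (b j) := by
  rw [dualCone, PointedCone.mem_dual]
  refine ⟨fun h j hj => h (basis_mem_orthant.2 hj), fun h v hv => ?_⟩
  change 0 ≤ f v
  rw [← b.sum_repr v, map_sum]
  refine Finset.sum_nonneg fun i _ => ?_
  rw [map_smul, smul_eq_mul]
  by_cases hi : i ∈ J
  · exact mul_nonneg (hv.1 i) (h i hi)
  · rw [hv.2 i hi, zero_mul]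

theorem isFacet_orthant_iff [DecidableEq ι] {γ : Cone N} :
    IsFacet γ (orthant b J) ↔ ∃ i ∈ J, γ = orthant b (J.erase i) := by
  constructor
  · rintro ⟨h1, h2, h3⟩
    obtain ⟨I, hI, rfl⟩ := h1.eq_orthant
    obtain ⟨i, hi, hiI⟩ := Finset.exists_of_ssubset
      (hI.ssubset_of_ne fun h => h2 (congrArg _ h))
    exact ⟨i, hi, (h3 _ (orthant_isFaceOf_orthant (Finset.erase_subset i J))
      (fun h => Finset.erase_ne_self.2 hi (orthant_injective h))
      (orthant_le_orthant.2 (Finset.subset_erase.2 ⟨hI, hiI⟩))).symm⟩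
  · rintro ⟨i, hi, rfl⟩
    refine ⟨orthant_isFaceOf_orthant (Finset.erase_subset i J),
      fun h => Finset.erase_ne_self.2 hi (orthant_injective h), fun δ h1 h2 h3 => ?_⟩
    obtain ⟨I, hI, rfl⟩ := h1.eq_orthant
    rw [orthant_le_orthant] at h3
    by_cases hiI : i ∈ I
    · refine absurd (congrArg (orthant b) (hI.antisymm fun j hj => ?_)) h2
      by_cases hji : j = i
      · exact hji ▸ hiI
      · exact h3 (Finset.mem_erase.2 ⟨hji, hj⟩)
    · rw [h3.antisymm (Finset.subset_erase.2 ⟨hI, hiI⟩)]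

theorem isExtremeRay_orthant_iff {γ : Cone N} :
    IsExtremeRay γ (orthant b J) ↔ ∃ i ∈ J, γ = orthant b {i} := by
  constructor
  · rintro ⟨h1, h2⟩
    obtain ⟨I, hI, rfl⟩ := h1.eq_orthant
    rw [dim_orthant, Finset.card_eq_one] at h2
    obtain ⟨i, rfl⟩ := h2
    exact ⟨i, hI (Finset.mem_singleton_self i), rfl⟩
  · rintro ⟨i, hi, rfl⟩
    exact ⟨orthant_isFaceOf_orthant (Finset.singleton_subset_iff.2 hi), by
      rw [dim_orthant, Finset.card_singleton]⟩

end Toric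

/-! ### Normal generators and multiplicities. -/

theorem Submodule.FG.exists_pos_generator_rat {P : Submodule ℤ ℚ} (hP : P.FG) (h0 : P ≠ ⊥) :
    ∃ g : ℚ, 0 < g ∧ P = Submodule.span ℤ {g} := by
  have h1 : IsFractional (nonZeroDivisors ℤ) P := FractionalIdeal.isFractional_of_fg hP
  have h2 := FractionalIdeal.isPrincipal (⟨P, h1⟩ : FractionalIdeal (nonZeroDivisors ℤ) ℚ)
  obtain ⟨g, hg⟩ := h2
  change P = _ at hg
  rcases lt_trichotomy g 0 with h | h | h
  · refine ⟨-g, neg_pos.2 h, ?_⟩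
    rw [hg, ← Set.neg_singleton, Submodule.span_neg]
  · exact absurd (by rw [hg, h, Submodule.span_zero_singleton]) h0
  · exact ⟨g, h, hg⟩

namespace Toric
open PointedCone

variable {ι N : Type*} [AddCommGroup N] {b : Module.Basis ι ℚ (NQ N)} {x : ι → N}
  {I J : Finset ι} {i : ι}

theorem mem_latticePoints {σ : Cone N} {z : N} : z ∈ latticePoints σ ↔ latticeMap N z ∈ σ := Iff.rfl

/-- A large multiple of the sum of the `x l`, l ∈ I, repairs the negative coordinates. I = J shows
that every lattice point of the span lies in N_σ; I = `J.erase i` moves a point into the cone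
without changing its i-th coordinate. -/
theorem exists_add_mem_latticePoints (hx : ∀ j, latticeMap N (x j) = b j) {z : N}
    (hz : ∀ j ∉ J, b.repr (latticeMap N z) j = 0) (hIJ : I ⊆ J)
    (hI : ∀ j ∉ I, 0 ≤ b.repr (latticeMap N z) j) :
    ∃ s ∈ latticePoints (orthant b I), z + s ∈ latticePoints (orthant b J) := by
  classical
  obtain ⟨k, hk⟩ : ∃ k : ℕ, ∀ j ∈ I, -b.repr (latticeMap N z) j ≤ k := by
    choose c hc using fun j => exists_nat_ge (-b.repr (latticeMap N z) j)
    exact ⟨I.sup c, fun j hj => (hc j).trans (by exact_mod_cast Finset.le_sup hj)⟩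
  have hs : ∀ j, b.repr (latticeMap N (k • ∑ l ∈ I, x l)) j = if j ∈ I then (k : ℚ) else 0 := by
    intro j
    simp only [map_nsmul, map_sum, hx, Finsupp.smul_apply, Finsupp.finsetSum_apply,
      Module.Basis.repr_self, Finsupp.single_apply, nsmul_eq_mul]
    rw [Finset.sum_ite_eq']
    split_ifs <;> simp
  refine ⟨k • ∑ l ∈ I, x l, ?_, ?_⟩
  · refine ⟨fun j => ?_, fun j hj => ?_⟩
    · change 0 ≤ b.repr (latticeMap N _) j
      rw [hs]; split_ifs <;> simp
    · change b.repr (latticeMap N _) j = 0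
      rw [hs, if_neg hj]
  · rw [mem_latticePoints, map_add]
    refine ⟨fun j => ?_, fun j hj => ?_⟩ <;> rw [map_add, Finsupp.add_apply, hs]
    · split_ifs with h
      · linarith [hk j h]
      · simpa using hI j h
    · rw [hz j hj, if_neg fun h => hj (hIJ h), add_zero]

theorem latticePoints_le_latticeSpan {σ : Cone N} {z : N} (hz : z ∈ latticePoints σ) :
    z ∈ latticeSpan σ := Submodule.subset_span hz

theorem mem_latticeSpan_orthant (hx : ∀ j, latticeMap N (x j) = b j) {z : N} :
    z ∈ latticeSpan (orthant b J) ↔ ∀ j ∉ J, b.repr (latticeMap N z) j = 0 := by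
  constructor
  · intro h j hj
    induction h using Submodule.span_induction with
    | mem z hz => exact (mem_latticePoints.1 hz).2 j hj
    | zero => simp
    | add y z _ _ hy hz => simp [hy, hz]
    | smul c z _ hz => simp [hz]
  · intro h
    obtain ⟨s, hs, hzs⟩ := exists_add_mem_latticePoints hx h subset_rfl
      (fun j hj => (h j hj).ge)
    rw [← add_sub_cancel_right z s]
    exact sub_mem (latticePoints_le_latticeSpan hzs) (latticePoints_le_latticeSpan hs)

theorem latticeSpan_mono {σ τ : Cone N} (h : σ ≤ τ) : latticeSpan σ ≤ latticeSpan τ :=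
  Submodule.span_mono fun _ hz => h hz

theorem mem_latticeSpan_orthant_erase [DecidableEq ι] (hx : ∀ j, latticeMap N (x j) = b j) {z : N}
    (hz : z ∈ latticeSpan (orthant b J)) (hi : b.repr (latticeMap N z) i = 0) :
    z ∈ latticeSpan (orthant b (J.erase i)) := by
  refine (mem_latticeSpan_orthant hx).2 fun j hj => ?_
  by_cases hij : j = i
  · rw [hij, hi]
  · exact (mem_latticeSpan_orthant hx).1 hz j fun h => hj (Finset.mem_erase.2 ⟨hij, h⟩)

/-- The i-th coordinate embeds N_τ/N_σ in ℚ as a finitely generated, hence cyclic, group gℤ with g >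
0. Some lattice point of the cone has coordinate g, and all of them have coordinates in gℕ. -/
theorem exists_isImageGenerator [DecidableEq ι] [Module.Finite ℤ N]
    (hx : ∀ j, latticeMap N (x j) = b j) (hi : i ∈ J) :
    ∃ u, IsImageGenerator (orthant b (J.erase i)) (orthant b J) u := by
  set φ : N →ₗ[ℤ] ℚ := ((b.coord i).restrictScalars ℤ).comp (latticeMap N) with hφ
  have hφ' : ∀ z, φ z = b.repr (latticeMap N z) i := fun z => rfl
  have hxJ : x i ∈ latticeSpan (orthant b J) :=
    latticePoints_le_latticeSpan (by rw [mem_latticePoints, hx]; exact basis_mem_orthant.2 hi)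
  have hφx : φ (x i) = 1 := by simp [hφ', hx]
  obtain ⟨g, hg, hP⟩ := Submodule.FG.exists_pos_generator_rat
    (P := (latticeSpan (orthant b J)).map φ) ((IsNoetherian.noetherian _).map φ) (by
      intro h
      have : φ (x i) ∈ (latticeSpan (orthant b J)).map φ := ⟨_, hxJ, rfl⟩
      rw [h, Submodule.mem_bot, hφx] at this
      exact one_ne_zero this)
  obtain ⟨y₀, hy₀, hy₀g⟩ : g ∈ (latticeSpan (orthant b J)).map φ :=
    hP ▸ Submodule.mem_span_singleton_self g
  obtain ⟨s, hs, hy⟩ := exists_add_mem_latticePoints hx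
    ((mem_latticeSpan_orthant hx).1 hy₀) (Finset.erase_subset i J) fun j hj => by
      by_cases hij : j = i
      · rw [hij]
        exact hg.le.trans_eq hy₀g.symm
      · exact ((mem_latticeSpan_orthant hx).1 hy₀ j
          fun h => hj (Finset.mem_erase.2 ⟨hij, h⟩)).ge
  have hyg : φ (y₀ + s) = g := by
    have hsi : φ s = 0 := (mem_latticePoints.1 hs).2 i (Finset.notMem_erase i J)
    rw [map_add, hsi, add_zero, hy₀g]
  refine ⟨Submodule.Quotient.mk ⟨y₀ + s, latticePoints_le_latticeSpan hy⟩, ?_⟩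
  refine le_antisymm ?_ ?_
  · rintro _ ⟨z, hz, rfl⟩
    have hz' : (z : N) ∈ latticePoints (orthant b J) := hz
    obtain ⟨k, hk⟩ := Submodule.mem_span_singleton.1
      (hP ▸ ⟨(z : N), z.2, rfl⟩ : φ z ∈ Submodule.span ℤ {g})
    have hk0 : 0 ≤ k := by
      by_contra hneg
      have h1 : (k : ℚ) < 0 := by exact_mod_cast not_le.1 hneg
      have h2 : 0 ≤ φ z := (mem_latticePoints.1 hz').1 i
      rw [← hk, zsmul_eq_mul] at h2
      linarith [mul_neg_of_neg_of_pos h1 hg]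
    obtain ⟨l, rfl⟩ := Int.eq_ofNat_of_zero_le hk0
    refine ⟨l, ?_⟩
    change l • Submodule.Quotient.mk _ = Submodule.Quotient.mk z
    rw [← Submodule.Quotient.mk_smul, eq_comm, Submodule.Quotient.eq]
    change (z : N) - l • (y₀ + s) ∈ latticeSpan (orthant b (J.erase i))
    refine mem_latticeSpan_orthant_erase hx
      (sub_mem z.2 (nsmul_mem (latticePoints_le_latticeSpan hy) l)) ?_
    rw [← hφ', map_sub, map_nsmul, hyg, ← hk]
    simp
  · rw [AddSubmonoid.multiples_le]
    exact ⟨⟨y₀ + s, latticePoints_le_latticeSpan hy⟩, hy, rfl⟩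

theorem exists_lift_normalGenerator [DecidableEq ι] [Module.Finite ℤ N]
    (hx : ∀ j, latticeMap N (x j) = b j) (hi : i ∈ J) :
    ∃ (y : latticeSpan (orthant b J)) (a : ℕ), a ≠ 0 ∧
      x i - a • (y : N) ∈ latticeSpan (orthant b (J.erase i)) ∧
      latticeSpan (orthant b J) ≤ latticeSpan (orthant b (J.erase i)) ⊔ Submodule.span ℤ {(y : N)} ∧
      normalGenerator (orthant b (J.erase i)) (orthant b J) = Submodule.Quotient.mk y := by
  -- Existence of a generator is enough: whichever one `Classical.epsilon` returns satisfies the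
  -- specification.
  have hu := Classical.epsilon_spec (exists_isImageGenerator hx hi)
  change IsImageGenerator _ _ (normalGenerator _ _) at hu
  set u := normalGenerator (orthant b (J.erase i)) (orthant b J)
  obtain ⟨y, hy, hyu⟩ := hu.ge (AddSubmonoid.mem_multiples u)
  have key : ∀ z : latticeSpan (orthant b J), (z : N) ∈ latticePoints (orthant b J) →
      ∃ k : ℕ, (z : N) - k • (y : N) ∈ latticeSpan (orthant b (J.erase i)) := by
    intro z hz
    obtain ⟨k, hk⟩ := hu.le ⟨z, hz, rfl⟩
    refine ⟨k, ?_⟩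
    change k • u = Submodule.Quotient.mk z at hk
    rw [← hyu] at hk
    change k • Submodule.Quotient.mk y = _ at hk
    rw [← Submodule.Quotient.mk_smul, eq_comm, Submodule.Quotient.eq] at hk
    exact hk
  have hxJ : x i ∈ latticePoints (orthant b J) := by
    rw [mem_latticePoints, hx]; exact basis_mem_orthant.2 hi
  obtain ⟨a, ha⟩ := key ⟨x i, latticePoints_le_latticeSpan hxJ⟩ hxJ
  refine ⟨y, a, ?_, ha, Submodule.span_le.2 fun z hz => ?_, hyu.symm⟩
  · rintro rfl
    have := (mem_latticeSpan_orthant hx).1 ha i (Finset.notMem_erase i J)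
    simp [hx] at this
  · obtain ⟨k, hk⟩ := key ⟨z, latticePoints_le_latticeSpan hz⟩ hz
    rw [SetLike.mem_coe, ← sub_add_cancel z (k • (y : N))]
    exact add_mem (Submodule.mem_sup_left hk) (Submodule.mem_sup_right
      (nsmul_mem (Submodule.mem_span_singleton_self _) k))

/-- The index in `N_σ` of the subgroup generated by the vectors `b j`, `j ∈ J`, where `σ` is the
cone generated by these vectors. -/
noncomputable def multiplicity (b : Module.Basis ι ℚ (NQ N)) (J : Finset ι) : ℕ :=
  (AddSubgroup.closure (b '' J)).relIndex
    ((latticeSpan (orthant b J)).toAddSubgroup.map (latticeMap N).toAddMonoidHom)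

theorem multiplicity_empty : multiplicity b ∅ = 1 := by
  have h : (latticeSpan (orthant b ∅)).toAddSubgroup.map (latticeMap N).toAddMonoidHom ≤ ⊥ := by
    rintro _ ⟨z, hz, rfl⟩
    have h0 : latticeSpan (orthant b ∅) ≤ LinearMap.ker (latticeMap N) :=
      Submodule.span_le.2 fun z hz => by
        have := mem_latticePoints.1 hz
        rwa [orthant_empty, Submodule.mem_bot] at this
    exact h0 hz
  rw [multiplicity, le_bot_iff.1 h, AddSubgroup.relIndex_bot_right]

/-- Modulo N of the facet, `b i` is a times the generator y. As y has i-th coordinate 1/a, no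
nonzero multiple of it lies in the facet's lattice, and `AddSubgroup.relIndex_sup_zmultiples`
applies. -/
theorem multiplicity_step [DecidableEq ι] (hx : ∀ j, latticeMap N (x j) = b j) (hi : i ∈ J)
    {y : N} (hyJ : y ∈ latticeSpan (orthant b J)) {a : ℕ} (ha : a ≠ 0)
    (hxy : x i - a • y ∈ latticeSpan (orthant b (J.erase i)))
    (hy : latticeSpan (orthant b J) ≤
      latticeSpan (orthant b (J.erase i)) ⊔ Submodule.span ℤ {y}) :
    multiplicity b J = a * multiplicity b (J.erase i) := by
  have hcoord : (a : ℚ) * b.repr (latticeMap N y) i = 1 := by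
    have := (mem_latticeSpan_orthant hx).1 hxy i (Finset.notMem_erase i J)
    simp only [map_sub, map_nsmul, hx, Finsupp.sub_apply, Finsupp.smul_apply,
      Module.Basis.repr_self, Finsupp.single_eq_same, nsmul_eq_mul] at this
    linarith
  have h1 : AddSubgroup.closure (b '' J) =
      AddSubgroup.closure (b '' (J.erase i)) ⊔ AddSubgroup.zmultiples (b i) := by
    rw [AddSubgroup.zmultiples_eq_closure, ← AddSubgroup.closure_union, ← Set.image_singleton,
      ← Set.image_union]
    congr 2
    rw [Finset.coe_erase, Set.sdiff_union_self, Set.union_eq_self_of_subset_right]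
    simpa using hi
  have h2 : (latticeSpan (orthant b J)).toAddSubgroup.map (latticeMap N).toAddMonoidHom =
      (latticeSpan (orthant b (J.erase i))).toAddSubgroup.map (latticeMap N).toAddMonoidHom ⊔
        AddSubgroup.zmultiples (latticeMap N y) := by
    refine le_antisymm ?_ (sup_le ?_ ?_)
    · rintro _ ⟨z, hz, rfl⟩
      obtain ⟨w, hw, v, hv, rfl⟩ := Submodule.mem_sup.1 (hy hz)
      obtain ⟨k, rfl⟩ := Submodule.mem_span_singleton.1 hv
      rw [map_add]
      refine add_mem (AddSubgroup.mem_sup_left ⟨w, hw, rfl⟩) (AddSubgroup.mem_sup_right ⟨k, ?_⟩)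
      exact (map_smul (latticeMap N) k y).symm
    · exact AddSubgroup.map_mono (latticeSpan_mono (orthant_le_orthant.2 (Finset.erase_subset i J)))
    · rw [AddSubgroup.zmultiples_le]
      exact ⟨y, hyJ, rfl⟩
  rw [multiplicity, h1, h2, AddSubgroup.relIndex_sup_zmultiples (a := a) ?_ ha ?_ ?_]
  · rfl
  · rw [AddSubgroup.closure_le]
    rintro _ ⟨j, hj, rfl⟩
    refine ⟨x j, latticePoints_le_latticeSpan ?_, hx j⟩
    rw [mem_latticePoints, hx]; exact basis_mem_orthant.2 hj
  · refine ⟨_, hxy, ?_⟩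
    change latticeMap N _ = _
    rw [map_sub, hx, map_nsmul]
  · rintro k ⟨z, hz, hzk⟩
    change latticeMap N z = _ at hzk
    have := (mem_latticeSpan_orthant hx).1 hz i (Finset.notMem_erase i J)
    rw [hzk, map_zsmul, Finsupp.smul_apply, zsmul_eq_mul, mul_eq_zero] at this
    rcases this with h | h
    · exact_mod_cast h
    · rw [h, mul_zero] at hcoord
      exact absurd hcoord zero_ne_one

theorem multiplicity_univ [Fintype ι] [DecidableEq ι] (hx : ∀ j, latticeMap N (x j) = b j)
    (β : Module.Basis ι ℤ N) :
    (multiplicity b Finset.univ : ℚ) = |(β.baseChange ℚ).det b| := by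
  rw [multiplicity, Finset.coe_univ, Set.image_univ]
  refine AddSubgroup.relIndex_eq_abs_det _ _ ?_ b (β.baseChange ℚ) rfl ?_
  · rw [AddSubgroup.closure_le]
    rintro _ ⟨j, rfl⟩
    exact ⟨x j, (mem_latticeSpan_orthant hx).2 (by simp), hx j⟩
  · have h1 : latticeSpan (orthant b Finset.univ) = ⊤ :=
      eq_top_iff.2 fun z _ => (mem_latticeSpan_orthant hx).2 (by simp)
    have h2 : (⊤ : Submodule ℤ N).toAddSubgroup = AddSubgroup.closure (Set.range β) := by
      rw [← β.span_eq, Submodule.span_int_eq_addSubgroupClosure]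
    rw [h1, h2, AddMonoidHom.map_closure, ← Set.range_comp]
    congr 2
    ext j
    exact (Module.Basis.baseChange_apply ℚ β j).symm

theorem pairing_mk {σ τ : Cone N} (f : perp σ) (y : latticeSpan τ) :
    pairing σ τ (Submodule.Quotient.mk f) (Submodule.Quotient.mk y) =
      (f : MQ N) (latticeMap N y) := rfl

/-- The functional π_σ(m) kills N_σ, so its value at `b i` is a times its value at the normal
generator; the same a is the ratio of the two multiplicities. This trades the generator for the
basis vector. -/
theorem multiplicity_mul_coeff [DecidableEq ι] [Module.Finite ℤ N] {Δ : Fan N}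
    (C : ChoiceOfComplements Δ) (D : QCartierDivisor Δ)
    (hx : ∀ j, latticeMap N (x j) = b j) (hi : i ∈ J) {σ τ : Δ.cones}
    (hσ : (σ : Cone N) = orthant b (J.erase i)) (hτ : (τ : Cone N) = orthant b J)
    (h : IsFacet (σ : Cone N) τ) {m : MQ N} (hm : Submodule.Quotient.mk m = D.localEq τ) :
    multiplicity b J * C.coeff D σ τ h =
      multiplicity b (J.erase i) * (C.proj σ m : MQ N) (b i) := by
  obtain ⟨σ, hσΔ⟩ := σ
  obtain ⟨τ, hτΔ⟩ := τ
  dsimp only at hσ hτ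
  subst hσ hτ
  obtain ⟨y, a, ha, hxy, hy, hgen⟩ := exists_lift_normalGenerator hx hi
  have h1 : C.coeff D ⟨_, hσΔ⟩ ⟨_, hτΔ⟩ h =
      (C.proj ⟨_, hσΔ⟩ m : MQ N) (latticeMap N y) := by
    rw [ChoiceOfComplements.coeff, ← hm, hgen]
    exact pairing_mk (C.proj ⟨_, hσΔ⟩ m) y
  have h2 := perp_apply_latticeSpan (C.proj ⟨_, hσΔ⟩ m).2 hxy
  rw [map_sub, map_nsmul, map_sub, map_nsmul, hx, sub_eq_zero, nsmul_eq_mul] at h2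
  rw [h1, multiplicity_step hx hi y.2 ha hxy hy, h2]
  push_cast
  ring

end Toric

/-! ### The simplex cut out by H, and the sign. -/

theorem Finset.prod_eq_neg_one_pow_mul_abs {ι : Type*} [Fintype ι] (f : ι → ℚ) :
    ∏ i, f i = (-1) ^ {i | f i < 0}.ncard * |∏ i, f i| := by
  classical
  have h1 : {i | f i < 0} = (Finset.univ.filter fun i => f i < 0 : Finset ι) := by ext; simp
  rw [h1, Set.ncard_coe_finset, ← Finset.prod_const, Finset.prod_filter, Finset.abs_prod,
    ← Finset.prod_mul_distrib]
  refine Finset.prod_congr rfl fun i _ => ?_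
  split_ifs with h
  · rw [abs_of_neg h]; ring
  · rw [abs_of_nonneg (not_lt.1 h), one_mul]

namespace Toric
open PointedCone

section Simplex

variable {ι N : Type*} [AddCommGroup N] [Fintype ι] {b : Module.Basis ι ℚ (NQ N)}

theorem mem_dualFace_orthant {J : Finset ι} {f : MQ N} :
    f ∈ dualFace (orthant b Finset.univ) (orthant b J) ↔
      (∀ j ∈ J, f (b j) = 0) ∧ ∀ j, 0 ≤ f (b j) := by
  rw [dualFace, Set.mem_inter_iff, SetLike.mem_coe, SetLike.mem_coe, mem_perp_orthant,
    mem_dualCone_orthant]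
  simp

/-- A functional vanishing at `b i` is the difference of its coordinatewise positive and negative
parts; both lie in the dual face, as does 0. -/
theorem mem_affineSpan_dualFace {i : ι} {f : MQ N} :
    f ∈ affineSpan ℚ (dualFace (orthant b Finset.univ) (orthant b {i})) ↔ f (b i) = 0 := by
  constructor
  · intro hf
    have h : affineSpan ℚ (dualFace (orthant b Finset.univ) (orthant b {i})) ≤
        (perp (orthant b {i})).toAffineSubspace := affineSpan_le.2 fun g hg => hg.1
    exact mem_perp_orthant.1 (Submodule.mem_toAffineSubspace.1 (h hf)) i
      (Finset.mem_singleton_self i)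
  · intro hf
    set p : MQ N := b.constr ℚ fun j => max (f (b j)) 0 with hp
    set q : MQ N := b.constr ℚ fun j => max (-f (b j)) 0 with hq
    have hpb : ∀ j, p (b j) = max (f (b j)) 0 := fun j => b.constr_basis ..
    have hqb : ∀ j, q (b j) = max (-f (b j)) 0 := fun j => b.constr_basis ..
    have h1 : p ∈ dualFace (orthant b Finset.univ) (orthant b {i}) :=
      mem_dualFace_orthant.2 ⟨by simp [hpb, hf], fun j => by simp [hpb]⟩
    have h2 : q ∈ dualFace (orthant b Finset.univ) (orthant b {i}) :=
      mem_dualFace_orthant.2 ⟨by simp [hqb, hf], fun j => by simp [hqb]⟩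
    have h0 : (0 : MQ N) ∈ dualFace (orthant b Finset.univ) (orthant b {i}) :=
      mem_dualFace_orthant.2 ⟨by simp, by simp⟩
    have hfpq : f = (p -ᵥ q) +ᵥ (0 : MQ N) := by
      refine b.ext fun j => ?_
      change f (b j) = p (b j) - q (b j) + 0
      rw [hpb, hqb]
      rcases le_total 0 (f (b j)) with h | h
      · rw [max_eq_left h, max_eq_right (by linarith)]; ring
      · rw [max_eq_right h, max_eq_left (by linarith)]; ring
    rw [hfpq]
    exact AffineSubspace.vadd_mem_of_mem_direction
      (AffineSubspace.vsub_mem_direction (subset_affineSpan ℚ _ h1) (subset_affineSpan ℚ _ h2))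
      (subset_affineSpan ℚ _ h0)

theorem apply_eq_of_apply_basis_eq_zero {f : MQ N} {l : NQ N} {i : ι}
    (hf : ∀ j ≠ i, f (b j) = 0) : f l = b.repr l i * f (b i) := by
  conv_lhs => rw [← b.sum_repr l, map_sum]
  rw [Finset.sum_eq_single i (fun j _ hj => by rw [map_smul, hf j hj, smul_zero]) (by simp),
    map_smul, smul_eq_mul]

variable {L : Submodule ℚ (MQ N)} {l : NQ N} {m : MQ N}

theorem mem_mk'_iff (hL : ∀ f, f ∈ L ↔ f l = 0) {f : MQ N} :
    f ∈ AffineSubspace.mk' m L ↔ f l = m l := by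
  rw [AffineSubspace.mem_mk', vsub_eq_sub, hL, LinearMap.sub_apply, sub_eq_zero]

/-- The dual face of the facet opposite to `b i` is the ray of nonnegative multiples of `b.coord i`,
and the hyperplane meets the line through that ray exactly at the multiple m(l)/l_i. -/
theorem mk'_inter_dualFace_eq_empty_iff [DecidableEq ι] (hL : ∀ f, f ∈ L ↔ f l = 0)
    {i : ι} (hl : b.repr l i ≠ 0) :
    ((AffineSubspace.mk' m L : AffineSubspace ℚ (MQ N)) : Set (MQ N)) ∩
      dualFace (orthant b Finset.univ) (orthant b (Finset.univ.erase i)) = ∅ ↔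
        m l / b.repr l i < 0 := by
  have hmem : ∀ f : MQ N, f ∈ dualFace (orthant b Finset.univ) (orthant b (Finset.univ.erase i)) ↔
      (∀ j ≠ i, f (b j) = 0) ∧ 0 ≤ f (b i) := by
    intro f
    rw [mem_dualFace_orthant]
    constructor
    · exact fun h => ⟨fun j hj => h.1 j (by simp [hj]), h.2 i⟩
    · refine fun h => ⟨fun j hj => h.1 j (Finset.mem_erase.1 hj).1, fun j => ?_⟩
      by_cases hj : j = i
      · exact hj ▸ h.2
      · exact (h.1 j hj).ge
  constructor
  · intro h
    by_contra hneg
    have hbi : ∀ j, ((m l / b.repr l i) • b.coord i : MQ N) (b j) =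
        if j = i then m l / b.repr l i else 0 := by
      intro j
      simp [Finsupp.single_apply]
    refine Set.eq_empty_iff_forall_notMem.1 h ((m l / b.repr l i) • b.coord i) ⟨?_, ?_⟩
    · rw [SetLike.mem_coe, mem_mk'_iff hL]
      simp [div_mul_cancel₀ _ hl]
    · refine (hmem _).2 ⟨fun j hj => by rw [hbi, if_neg hj], ?_⟩
      rw [hbi, if_pos rfl]
      exact not_lt.1 hneg
  · intro h
    refine Set.eq_empty_iff_forall_notMem.2 fun f hf => ?_
    obtain ⟨h1, h2⟩ := hf
    rw [SetLike.mem_coe, mem_mk'_iff hL] at h1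
    rw [hmem] at h2
    rw [apply_eq_of_apply_basis_eq_zero h2.1] at h1
    rw [← h1, mul_div_cancel_left₀ _ hl] at h
    exact absurd h (not_lt.2 h2.2)

end Simplex

section Vertices

variable {N : Type*} [AddCommGroup N] {n : ℕ} (b : Module.Basis (Fin n) ℚ (NQ N)) (l : NQ N)
  (m : MQ N)

/-- The vertices of the simplex cut out of the cone dual to the one generated by `b` by the
hyperplane of all functionals that agree with `m` on `l`. -/
noncomputable def simplexVertex : Fin (n + 1) → MQ N :=
  Fin.cons 0 fun i => (m l / b.repr l i) • b.coord i

variable {b l m} {L : Submodule ℚ (MQ N)}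

theorem isSimplexOf_simplexVertex [Module.Free ℤ N] [Module.Finite ℤ N]
    (hL : ∀ f, f ∈ L ↔ f l = 0) (hl : ∀ i, b.repr l i ≠ 0) :
    IsSimplexOf (Fin.cons (AffineSubspace.mk' m L) fun i =>
      affineSpan ℚ (dualFace (orthant b Finset.univ) (orthant b {i}))) (simplexVertex b l m) := by
  intro i
  ext f
  simp only [Set.mem_iInter, SetLike.mem_coe, Set.mem_singleton_iff, Subtype.forall]
  induction i using Fin.cases with
  | zero =>
    simp only [simplexVertex, Fin.cons_zero]
    constructor
    · intro h
      exact b.ext fun j => mem_affineSpan_dualFace.1 (h j.succ (Fin.succ_ne_zero j))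
    · rintro rfl j hj
      obtain ⟨j, rfl⟩ := Fin.exists_succ_eq.2 hj
      exact mem_affineSpan_dualFace.2 rfl
  | succ i =>
    simp only [simplexVertex, Fin.cons_succ]
    constructor
    · intro h
      have h0 : f l = m l := (mem_mk'_iff hL).1 (h 0 (Fin.succ_ne_zero i).symm)
      have hj : ∀ j ≠ i, f (b j) = 0 := fun j hj =>
        mem_affineSpan_dualFace.1 (h j.succ fun h => hj (Fin.succ_injective _ h))
      rw [apply_eq_of_apply_basis_eq_zero hj] at h0
      refine b.ext fun j => ?_
      by_cases hji : j = i
      · subst hji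
        simp [← h0, hl j]
      · simp [hj j hji, hji]
    · rintro rfl j hj
      induction j using Fin.cases with
      | zero =>
        refine (mem_mk'_iff hL).2 ?_
        simp [div_mul_cancel₀ _ (hl i)]
      | succ j =>
        refine mem_affineSpan_dualFace.2 ?_
        have : j ≠ i := fun h => hj (h ▸ rfl)
        simp [this]

theorem affineIndependent_simplexVertex (hm : m l ≠ 0) (hl : ∀ i, b.repr l i ≠ 0) :
    AffineIndependent ℚ (simplexVertex b l m) := by
  rw [affineIndependent_iff_linearIndependent_vsub ℚ _ 0,
    ← linearIndependent_equiv (finSuccAboveEquiv (0 : Fin (n + 1))),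
    Fintype.linearIndependent_iff]
  intro g hg i
  have h := LinearMap.congr_fun hg (b i)
  simp only [simplexVertex, Function.comp_apply, finSuccAboveEquiv_apply,
    Fin.zero_succAbove, Fin.cons_succ, Fin.cons_zero, vsub_eq_sub, sub_zero,
    LinearMap.sum_apply, LinearMap.smul_apply, Module.Basis.coord_apply, Module.Basis.repr_self,
    smul_eq_mul, LinearMap.zero_apply] at h
  rw [Finset.sum_eq_single i (fun j _ hj => by rw [Finsupp.single_eq_of_ne hj]; simp) (by simp),
    Finsupp.single_eq_same, mul_one, mul_eq_zero] at h
  exact h.resolve_right (div_ne_zero hm (hl i))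

end Vertices

/-! ### The volume of the simplex. -/

section Volume

variable {N : Type*} [AddCommGroup N] [Module.Free ℤ N] [Module.Finite ℤ N]
  {b : Module.Basis (Fin (Module.finrank ℤ N)) ℚ (NQ N)} {x : Fin (Module.finrank ℤ N) → N}
  {l : NQ N} {m : MQ N}

theorem multiplicity_univ_ne_zero (hx : ∀ j, latticeMap N (x j) = b j) :
    (multiplicity b Finset.univ : ℚ) ≠ 0 := by
  rw [multiplicity_univ hx (Module.finBasis ℤ N), abs_ne_zero]
  exact (Module.Basis.isUnit_det _ b).ne_zero

/-- The edge matrix at the vertex 0 is diagonal times the change of basis from a lattice basis to b,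
and the multiplicity is the absolute determinant of the inverse change. -/
theorem factorial_mul_latticeVolume_simplexVertex (hx : ∀ j, latticeMap N (x j) = b j) :
    (Module.finrank ℤ N).factorial * latticeVolume (simplexVertex b l m) *
      multiplicity b Finset.univ = |∏ i, m l / b.repr l i| := by
  set β := (Module.finBasis ℤ N).baseChange ℚ with hβ
  have h1 : (Matrix.of fun i j : Fin (Module.finrank ℤ N) =>
      (simplexVertex b l m i.succ - simplexVertex b l m 0)
        (latticeMap N (Module.finBasis ℤ N j))) =
      Matrix.diagonal (fun i => m l / b.repr l i) * b.toMatrix β := by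
    ext i j
    rw [Matrix.diagonal_mul, Matrix.of_apply, Module.Basis.toMatrix_apply, hβ,
      Module.Basis.baseChange_apply]
    simp only [simplexVertex, Fin.cons_succ, Fin.cons_zero, sub_zero]
    rfl
  have h2 : |(b.toMatrix β).det| * |β.det b| = 1 := by
    rw [Module.Basis.det_apply, ← abs_mul, ← Matrix.det_mul,
      Module.Basis.toMatrix_mul_toMatrix_flip, Matrix.det_one, abs_one]
  have h3 : ((Module.finrank ℤ N).factorial : ℚ) ≠ 0 := by
    exact_mod_cast Nat.factorial_ne_zero _
  rw [latticeVolume, h1, Matrix.det_mul, Matrix.det_diagonal, abs_mul,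
    multiplicity_univ hx (Module.finBasis ℤ N), ← mul_assoc, mul_one_div_cancel h3, one_mul,
    mul_assoc, h2, mul_one]

end Volume

/-! ### Annihilators of the flag and genericity. -/

section Flag

variable {N : Type*} [AddCommGroup N] {ι : Type*} [Fintype ι] {b : Module.Basis ι ℚ (NQ N)}

theorem apply_eq_zero_of_mem_perp {J : Finset ι} {v : NQ N}
    (hv : ∀ j ∉ J, b.repr v j = 0) {f : MQ N} (hf : f ∈ perp (orthant b J)) : f v = 0 :=
  (Submodule.mem_dualAnnihilator f).1 hf v (mem_span_orthant.2 hv)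

variable [Module.Free ℤ N]

theorem finrank_MQ : Module.finrank ℚ (MQ N) = Module.finrank ℤ N :=
  Subspace.dual_finrank_eq.trans Module.finrank_baseChange

theorem card_le_finrank (b : Module.Basis ι ℚ (NQ N)) (J : Finset ι) :
    J.card ≤ Module.finrank ℤ N :=
  (Finset.card_le_univ J).trans_eq
    ((Module.finrank_eq_card_basis b).symm.trans Module.finrank_baseChange)

variable [Module.Finite ℤ N]

theorem CompleteFlag.finrank_eq (𝓛 : CompleteFlag N) {k : ℕ} (hk : k ≤ Module.finrank ℤ N) :
    Module.finrank ℚ (𝓛.L k) = k := by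
  refine le_antisymm ?_ (𝓛.le_finrank hk)
  induction hk using Nat.decreasingInduction with
  | self => exact (Submodule.finrank_le _).trans_eq finrank_MQ
  | of_succ k hk ih =>
    have := Submodule.finrank_lt_finrank_of_lt (𝓛.lt_succ k hk)
    omega

variable (𝓛 : CompleteFlag N)

/-- Dimension count: evaluation maps the |J|-dimensional span of the cone to the dual of a (|J| -
1)-dimensional space, so it has a kernel. -/
theorem CompleteFlag.exists_mem_dualCoannihilator {J : Finset ι} (hJ : J.Nonempty) :
    ∃ v ∈ (𝓛.L (J.card - 1)).dualCoannihilator, v ≠ 0 ∧ ∀ j ∉ J, b.repr v j = 0 := by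
  have hpos := hJ.card_pos
  have hJn := card_le_finrank b J
  set S := Submodule.span ℚ (orthant b J : Set (NQ N))
  set φ : S →ₗ[ℚ] Module.Dual ℚ (𝓛.L (J.card - 1)) :=
    (𝓛.L (J.card - 1)).dualRestrict.comp ((Module.Dual.eval ℚ (NQ N)).comp S.subtype) with hφ
  have hlt : Module.finrank ℚ (Module.Dual ℚ (𝓛.L (J.card - 1))) < Module.finrank ℚ S := by
    rw [Subspace.dual_finrank_eq, 𝓛.finrank_eq (by omega), finrank_span_orthant]
    omega
  obtain ⟨v, hv, hv0⟩ := (Submodule.ne_bot_iff _).1 (LinearMap.ker_ne_bot_of_finrank_lt hlt)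
  refine ⟨v, (Submodule.mem_dualCoannihilator _).2 fun f hf => ?_, fun h => hv0 (Subtype.ext h),
    mem_span_orthant.1 v.2⟩
  have hφv : φ v = 0 := hv
  exact LinearMap.congr_fun hφv ⟨f, hf⟩

variable {𝓛}

theorem CompleteFlag.mem_iff_apply_eq_zero {l : NQ N} (hl0 : l ≠ 0)
    (hl : l ∈ (𝓛.L (Module.finrank ℤ N - 1)).dualCoannihilator) (f : MQ N) :
    f ∈ 𝓛.L (Module.finrank ℤ N - 1) ↔ f l = 0 := by
  have h1 : 𝓛.L (Module.finrank ℤ N - 1) ≤ LinearMap.ker (Module.Dual.eval ℚ (NQ N) l) :=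
    fun f hf => (Submodule.mem_dualCoannihilator _).1 hl f hf
  have h2 : LinearMap.ker (Module.Dual.eval ℚ (NQ N) l) ≠ ⊤ := by
    intro h
    refine hl0 ((Module.forall_dual_apply_eq_zero_iff ℚ l).1 fun f => ?_)
    exact (h ▸ Submodule.mem_top : f ∈ LinearMap.ker (Module.Dual.eval ℚ (NQ N) l))
  have h3 := Submodule.finrank_lt h2
  rw [finrank_MQ] at h3
  rw [Submodule.eq_of_le_of_finrank_le h1 (by
    rw [𝓛.finrank_eq (Nat.sub_le _ _)]; exact Nat.le_sub_one_of_lt h3)]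
  rfl

/-- Genericity splits every functional into one vanishing on the cone and one in `𝓛.L J.card`; both
kill v. -/
theorem CompleteFlag.IsGeneric.eq_zero {Δ : Fan N} (hgen : 𝓛.IsGeneric Δ) {J : Finset ι}
    (hJ : orthant b J ∈ Δ.cones) {v : NQ N} (hv : v ∈ (𝓛.L J.card).dualCoannihilator)
    (hvJ : ∀ j ∉ J, b.repr v j = 0) : v = 0 := by
  refine (Module.forall_dual_apply_eq_zero_iff ℚ v).1 fun f => ?_
  have h := ((𝓛.complements hgen).isCompl ⟨_, hJ⟩).sup_eq_top
  obtain ⟨p, hp, q, hq, rfl⟩ := Submodule.mem_sup.1 (h ▸ Submodule.mem_top : f ∈ _)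
  change q ∈ 𝓛.L (dim (orthant b J)) at hq
  rw [dim_orthant] at hq
  rw [LinearMap.add_apply, apply_eq_zero_of_mem_perp hvJ hp,
    (Submodule.mem_dualCoannihilator _).1 hv q hq, add_zero]

end Flag

end Toric

/-! ### The recursion for the coefficients of the powers of D. -/

theorem Submodule.sub_projectionOnto_mem {R E : Type*} [Ring R] [AddCommGroup E] [Module R E]
    {p q : Submodule R E} (h : IsCompl p q) (x : E) : x - p.projectionOnto q h x ∈ q := by
  rw [← Submodule.projectionOnto_apply_eq_zero_iff h, map_sub,
    Submodule.projectionOnto_apply_left, sub_self]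

namespace Toric
open PointedCone

section Recursion

variable {N : Type*} [AddCommGroup N] {Δ : Fan N}

open Classical in
theorem ChoiceOfComplements.divisorPow_succ_apply (C : ChoiceOfComplements Δ)
    (D : QCartierDivisor Δ) (k : ℕ) (τ : Δ.cones) :
    C.divisorPow D (k + 1) τ = ∑ σ : Δ.cones, C.divisorPow D k σ *
      if h : IsFacet (σ : Cone N) τ then C.coeff D σ τ h else 0 := by
  have h1 : C.divisorPow D (k + 1) = C.act D (C.divisorPow D k) := by
    rw [divisorPow, divisorPow, pow_succ', Module.End.mul_apply]
  rw [h1, act, Finsupp.linearCombination_apply, Finsupp.sum_fintype _ _ (by simp),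
    Finsupp.finsetSum_apply]
  refine Finset.sum_congr rfl fun σ _ => ?_
  rw [Finsupp.smul_apply, smul_eq_mul, Finsupp.finsetSum_apply]
  congr 1
  rw [Finset.sum_eq_single τ]
  · split_ifs <;> simp [orbitClosure]
  · intro γ _ hγ
    split_ifs <;> simp [orbitClosure, hγ]
  · simp

variable {ι : Type*} [Fintype ι] {b : Module.Basis ι ℚ (NQ N)}

theorem QCartierDivisor.localEq_orthant (D : QCartierDivisor Δ)
    (hΔ : ∀ J : Finset ι, orthant b J ∈ Δ.cones) {m : MQ N}
    (hm : Submodule.Quotient.mk m = D.localEq ⟨_, hΔ Finset.univ⟩) (J : Finset ι) :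
    Submodule.Quotient.mk m = D.localEq ⟨_, hΔ J⟩ := by
  rw [← D.compat ⟨_, hΔ Finset.univ⟩ ⟨_, hΔ J⟩ (orthant_isFaceOf_orthant (Finset.subset_univ J)),
    ← hm]
  rfl

variable [DecidableEq ι] (hΔ : ∀ J : Finset ι, orthant b J ∈ Δ.cones)

theorem multiplicity_mul_divisorPow [Module.Finite ℤ N] {x : ι → N}
    (hx : ∀ j, latticeMap N (x j) = b j) (C : ChoiceOfComplements Δ) (D : QCartierDivisor Δ)
    {m : MQ N} (hm : Submodule.Quotient.mk m = D.localEq ⟨_, hΔ Finset.univ⟩)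
    {J : Finset ι} (hJ : J.Nonempty) :
    multiplicity b J * C.divisorPow D J.card ⟨_, hΔ J⟩ =
      ∑ i ∈ J, multiplicity b (J.erase i) *
        C.divisorPow D (J.erase i).card ⟨_, hΔ (J.erase i)⟩ *
          (C.proj ⟨_, hΔ (J.erase i)⟩ m : MQ N) (b i) := by
  classical
  obtain ⟨k, hk⟩ : ∃ k, J.card = k + 1 := ⟨J.card - 1, by have := hJ.card_pos; omega⟩
  set g : ι → Δ.cones := fun i => ⟨orthant b (J.erase i), hΔ (J.erase i)⟩ with hg
  have hginj : Set.InjOn g J := by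
    intro i hi j hj hij
    have h1 : J.erase i = J.erase j := orthant_injective (Subtype.ext_iff.1 hij)
    by_contra hne
    exact Finset.notMem_erase i J (h1 ▸ Finset.mem_erase.2 ⟨hne, hi⟩)
  rw [hk, C.divisorPow_succ_apply, ← Finset.sum_subset (Finset.subset_univ (J.image g)),
    Finset.sum_image hginj, Finset.mul_sum]
  · refine Finset.sum_congr rfl fun i hi => ?_
    have hf : IsFacet (g i : Cone N) (orthant b J) := isFacet_orthant_iff.2 ⟨i, hi, rfl⟩
    have h1 := multiplicity_mul_coeff C D hx hi (σ := g i) (τ := ⟨_, hΔ J⟩) rfl rfl hf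
      (D.localEq_orthant hΔ hm J)
    rw [dif_pos hf, Finset.card_erase_of_mem hi, hk, Nat.add_sub_cancel, mul_left_comm, h1]
    ring
  · intro γ _ hγ
    rw [dif_neg, mul_zero]
    intro hf
    obtain ⟨i, hi, hγi⟩ := isFacet_orthant_iff.1 hf
    exact hγ (Finset.mem_image.2 ⟨i, hi, Subtype.ext hγi.symm⟩)

variable [Module.Free ℤ N] [Module.Finite ℤ N] {𝓛 : CompleteFlag N}

theorem CompleteFlag.proj_complements_apply_mul (hgen : 𝓛.IsGeneric Δ) {I : Finset ι} {i : ι}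
    {v : NQ N} (hv : v ∈ (𝓛.L I.card).dualCoannihilator)
    (hvI : ∀ j ∉ insert i I, b.repr v j = 0) (m : MQ N) :
    ((𝓛.complements hgen).proj ⟨_, hΔ I⟩ m : MQ N) (b i) * b.repr v i = m v := by
  set C := 𝓛.complements hgen
  set f := C.proj ⟨_, hΔ I⟩ m
  have h1 : m - f ∈ 𝓛.L I.card := by
    have h3 : m - f ∈ 𝓛.L (dim (orthant b I)) :=
      Submodule.sub_projectionOnto_mem (C.isCompl ⟨_, hΔ I⟩) m
    rwa [dim_orthant] at h3
  have h4 := (Submodule.mem_dualCoannihilator _).1 hv _ h1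
  have h5 : (f : MQ N) v = b.repr v i * (f : MQ N) (b i) := by
    conv_lhs => rw [← b.sum_repr v, map_sum]
    rw [Finset.sum_eq_single i (fun j _ hj => ?_) (by simp), map_smul, smul_eq_mul]
    rw [map_smul, smul_eq_mul]
    by_cases hjI : j ∈ I
    · rw [mem_perp_orthant.1 f.2 j hjI, mul_zero]
    · rw [hvI j (by simp [hj, hjI]), zero_mul]
  rw [LinearMap.sub_apply, sub_eq_zero] at h4
  rw [h4, h5, mul_comm]

theorem CompleteFlag.multiplicity_mul_divisorPow_mul_prod (hgen : 𝓛.IsGeneric Δ)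
    {x : ι → N} (hx : ∀ j, latticeMap N (x j) = b j) (D : QCartierDivisor Δ)
    {m : MQ N} (hm : Submodule.Quotient.mk m = D.localEq ⟨_, hΔ Finset.univ⟩)
    {J : Finset ι} (hJ : J.Nonempty) {v : NQ N}
    (hv : v ∈ (𝓛.L (J.card - 1)).dualCoannihilator) (hv0 : v ≠ 0)
    (hvJ : ∀ j ∉ J, b.repr v j = 0) :
    multiplicity b J * (𝓛.complements hgen).divisorPow D J.card ⟨_, hΔ J⟩ *
      ∏ j ∈ J, b.repr v j = m v ^ J.card := by
  refine flag_recursion b (fun k => (𝓛.L k).dualCoannihilator) (fun J k hk => ?_)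
    (fun J v hv hvJ => hgen.eq_zero (hΔ J) hv hvJ)
    (fun J hJ => 𝓛.exists_mem_dualCoannihilator hJ) m
    (fun J => multiplicity b J * (𝓛.complements hgen).divisorPow D J.card ⟨_, hΔ J⟩)
    (fun I i => ((𝓛.complements hgen).proj ⟨_, hΔ I⟩ m : MQ N) (b i)) ?_
    (fun J hJ => multiplicity_mul_divisorPow hΔ hx _ D hm hJ)
    (fun I i _ v hv hvI => 𝓛.proj_complements_apply_mul hΔ hgen hv hvI m) J hJ v hv hv0 hvJ
  · have h1 := (hk.trans_le (card_le_finrank b J))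
    exact Submodule.dualCoannihilator_anti (𝓛.mono (Nat.le_succ k) h1)
  · have h1 : (⟨⊥, Δ.bot_mem⟩ : Δ.cones) = ⟨orthant b ∅, hΔ ∅⟩ := Subtype.ext orthant_empty.symm
    simp [multiplicity_empty, ChoiceOfComplements.divisorPow, fundamentalCycle, orbitClosure, h1]

end Recursion

/-! ### A lattice basis adapted to a simplicial cone. -/

section Simplicial

variable {N : Type*} [AddCommGroup N]

theorem exists_pos_nsmul_mem_range_latticeMap (v : NQ N) :
    ∃ d : ℕ, d ≠ 0 ∧ ∃ z : N, latticeMap N z = d • v := by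
  induction v using TensorProduct.induction_on with
  | zero => exact ⟨1, one_ne_zero, 0, by simp⟩
  | tmul q z =>
    refine ⟨q.den, q.den_ne_zero, q.num • z, ?_⟩
    change (1 : ℚ) ⊗ₜ[ℤ] (q.num • z) = _
    rw [TensorProduct.tmul_smul, TensorProduct.smul_tmul', TensorProduct.smul_tmul']
    congr 1
    rw [nsmul_eq_mul, zsmul_eq_mul, mul_one, Rat.den_mul_eq_num]
  | add v w hv hw =>
    obtain ⟨d, hd, y, hy⟩ := hv
    obtain ⟨e, he, z, hz⟩ := hw
    refine ⟨d * e, mul_ne_zero hd he, e • y + d • z, ?_⟩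
    rw [map_add, map_nsmul, map_nsmul, hy, hz, smul_add, mul_smul, mul_smul, smul_comm e d v]

theorem orthant_isUnitSMul {ι V : Type*} [AddCommGroup V] [Module ℚ V]
    (b : Module.Basis ι ℚ V) {c : ι → ℚ} (hc : ∀ i, 0 < c i) (J : Finset ι) :
    orthant (b.isUnitSMul fun i => (hc i).ne'.isUnit) J = orthant b J := by
  have h : ∀ v i, c i * (b.isUnitSMul fun i => (hc i).ne'.isUnit).repr v i = b.repr v i := by
    intro v i
    rw [Module.Basis.repr_isUnitSMul, Units.smul_def, smul_eq_mul, ← mul_assoc]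
    simp [(hc i).ne']
  ext v
  simp only [mem_orthant, ← h, mul_nonneg_iff_of_pos_left (hc _), mul_eq_zero, (hc _).ne',
    false_or]

/-- The independent generators of σ form a basis by dimension; reindex it by the rays and clear
denominators. The lattice vectors need not be primitive, as multiplicities account for this. Since κ
is only `Finite`, the full index set enters as any J containing every i. -/
theorem exists_basis_of_isSimplicial [Module.Free ℤ N] [Module.Finite ℤ N] {σ : Cone N}
    (hdim : dim σ = Module.finrank ℤ N) (hsimp : σ.IsSimplicial) {κ : Type*} [Finite κ]
    {ρ : κ → Cone N} (hρ_inj : Function.Injective ρ)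
    (hρ : ∀ γ : Cone N, IsExtremeRay γ σ ↔ ∃ i, ρ i = γ) :
    ∃ (b : Module.Basis κ ℚ (NQ N)) (x : κ → N), (∀ i, latticeMap N (x i) = b i) ∧
      (∀ i, ρ i = orthant b {i}) ∧ ∀ J : Finset κ, (∀ i, i ∈ J) → σ = orthant b J := by
  classical
  have := Fintype.ofFinite κ
  obtain ⟨s, hs, hli, rfl⟩ := hsimp
  have := hs.fintype
  have hli' : LinearIndependent ℚ ((↑) : s → NQ N) := hli
  have hspan : ⊤ ≤ Submodule.span ℚ (Set.range ((↑) : s → NQ N)) := by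
    rw [Subtype.range_coe, top_le_iff]
    have h1 : linearSpan (hull ℚ s) = Submodule.span ℚ s :=
      le_antisymm (Submodule.span_le.2 (hull_le_span (R := ℚ) s)) (Submodule.span_mono (subset_hull (R := ℚ)))
    rw [← h1]
    exact Submodule.eq_top_of_finrank_eq (hdim.trans Module.finrank_baseChange.symm)
  set b₀ : Module.Basis s ℚ (NQ N) := Module.Basis.mk hli' hspan with hb₀
  have hσ : hull ℚ s = orthant b₀ Finset.univ := by
    rw [orthant_univ, hb₀, Module.Basis.coe_mk, Subtype.range_coe]
  rw [hσ] at hρ ⊢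
  have hray : ∀ i, ∃ j, ρ i = orthant b₀ {j} := fun i => by
    obtain ⟨j, -, hj⟩ := isExtremeRay_orthant_iff.1 ((hρ (ρ i)).2 ⟨i, rfl⟩)
    exact ⟨j, hj⟩
  choose e he using hray
  have he_bij : Function.Bijective e := by
    refine ⟨fun i j hij => hρ_inj (by rw [he, he, hij]), fun j => ?_⟩
    obtain ⟨i, hi⟩ := (hρ (orthant b₀ {j})).1
      (isExtremeRay_orthant_iff.2 ⟨j, Finset.mem_univ j, rfl⟩)
    rw [he] at hi
    exact ⟨i, Finset.singleton_injective (orthant_injective hi)⟩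
  set ε := Equiv.ofBijective e he_bij
  have hreindex : ∀ J : Finset κ, orthant (b₀.reindex ε.symm) J = orthant b₀ (J.map ε) := by
    intro J
    ext v
    simp only [mem_orthant, Module.Basis.repr_reindex_apply, Equiv.symm_symm, Finset.mem_map_equiv]
    constructor
    · exact fun h => ⟨fun j => by simpa using h.1 (ε.symm j), fun j hj => by
        simpa using h.2 (ε.symm j) hj⟩
    · exact fun h => ⟨fun j => h.1 (ε j), fun j hj => h.2 (ε j) (by simpa using hj)⟩
  choose d hd x hx using fun i => exists_pos_nsmul_mem_range_latticeMap (b₀.reindex ε.symm i)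
  have hd' : ∀ i, 0 < (d i : ℚ) := fun i => by exact_mod_cast Nat.pos_of_ne_zero (hd i)
  refine ⟨(b₀.reindex ε.symm).isUnitSMul fun i => (hd' i).ne'.isUnit, x, fun i => ?_, fun i => ?_,
    fun J hJ => ?_⟩
  · rw [hx, Module.Basis.isUnitSMul_apply, Nat.cast_smul_eq_nsmul]
  · rw [orthant_isUnitSMul _ hd', hreindex, he, Finset.map_singleton]
    rfl
  · rw [orthant_isUnitSMul _ hd', hreindex]
    congr 1
    exact (Finset.eq_univ_of_forall fun j => Finset.mem_map_equiv.2 (hJ _)).symm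

theorem eq_orthant_erase_of_isFacet {ι : Type*} [Fintype ι] [DecidableEq ι]
    {b : Module.Basis ι ℚ (NQ N)} {τ : Cone N} {i : ι}
    (hτ : IsFacet τ (orthant b Finset.univ)) (hi : ¬ orthant b {i} ≤ τ) :
    τ = orthant b (Finset.univ.erase i) := by
  obtain ⟨j, -, rfl⟩ := isFacet_orthant_iff.1 hτ
  rw [orthant_le_orthant, Finset.singleton_subset_iff, Finset.mem_erase] at hi
  have : i = j := by simpa using hi
  rw [this]

end Simplicial

end Toric

theorem theorem14p1 {N : Type*} [AddCommGroup N] [Module.Free ℤ N] [Module.Finite ℤ N]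
    (hN : 1 ≤ Module.finrank ℤ N)
    (Δ : Toric.Fan N) (𝓛 : Toric.CompleteFlag N) (hgen : 𝓛.IsGeneric Δ)
    (D : Toric.QCartierDivisor Δ)
    (σ : Δ.cones) (hdim : Toric.dim (σ : Toric.Cone N) = Module.finrank ℤ N)
    (hsimp : (σ : Toric.Cone N).IsSimplicial)
    (m : Toric.MQ N) (hm : Submodule.Quotient.mk m = D.localEq σ)
    (ρ τ : Fin (Module.finrank ℤ N) → Toric.Cone N)
    (hρ_inj : Function.Injective ρ)
    (hρ : ∀ γ : Toric.Cone N, Toric.IsExtremeRay γ (σ : Toric.Cone N) ↔ ∃ i, ρ i = γ)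
    (hτ : ∀ i, Toric.IsFacet (τ i) (σ : Toric.Cone N) ∧ ¬ ρ i ≤ τ i)
    (H : AffineSubspace ℚ (Toric.MQ N))
    (hH : H = AffineSubspace.mk' m (𝓛.L (Module.finrank ℤ N - 1))) :
    ∃ v : Fin (Module.finrank ℤ N + 1) → Toric.MQ N,
      Toric.IsSimplexOf
        (Fin.cons H fun i => affineSpan ℚ (Toric.dualFace (σ : Toric.Cone N) (ρ i))) v ∧
      (m ∉ 𝓛.L (Module.finrank ℤ N - 1) → AffineIndependent ℚ v) ∧
      (𝓛.complements hgen).divisorPow D (Module.finrank ℤ N) σ =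
        (-1) ^ {i | (H : Set (Toric.MQ N)) ∩ Toric.dualFace (σ : Toric.Cone N) (τ i) = ∅}.ncard *
          ((Module.finrank ℤ N).factorial * Toric.latticeVolume v) := by
  obtain ⟨b, x, hx, hρb, hσb⟩ := Toric.exists_basis_of_isSimplicial hdim hsimp hρ_inj hρ
  obtain ⟨σ, hσ⟩ := σ
  obtain rfl : σ = PointedCone.orthant b Finset.univ := hσb _ Finset.mem_univ
  obtain rfl : ρ = fun i => PointedCone.orthant b {i} := funext hρb
  obtain rfl : τ = fun i => PointedCone.orthant b (Finset.univ.erase i) :=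
    funext fun i => Toric.eq_orthant_erase_of_isFacet (hτ i).1 (hτ i).2
  subst hH
  have hΔ : ∀ J, PointedCone.orthant b J ∈ Δ.cones := fun J =>
    Δ.face_mem _ hσ _ (PointedCone.orthant_isFaceOf_orthant (Finset.subset_univ J))
  have hne : (Finset.univ : Finset (Fin (Module.finrank ℤ N))).Nonempty :=
    ⟨⟨0, hN⟩, Finset.mem_univ _⟩
  -- This l is the linear equation of L_{n-1}, hence the normal vector of H.
  obtain ⟨l, hl, hl0, hlJ⟩ := 𝓛.exists_mem_dualCoannihilator (b := b) hne
  have hcoord : ∀ i, b.repr l i ≠ 0 := fun i =>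
    repr_ne_zero_of_disjoint_flag b (fun k => (𝓛.L k).dualCoannihilator)
      (fun J v hv hvJ => hgen.eq_zero (hΔ J) hv hvJ) hl hl0 hlJ i (Finset.mem_univ i)
  have hpow := 𝓛.multiplicity_mul_divisorPow_mul_prod hΔ hgen hx D hm hne hl hl0 hlJ
  rw [Finset.card_univ, Fintype.card_fin] at hl hpow
  have hL := Toric.CompleteFlag.mem_iff_apply_eq_zero hl0 hl
  refine ⟨Toric.simplexVertex b l m, Toric.isSimplexOf_simplexVertex hL hcoord,
    fun hmL => Toric.affineIndependent_simplexVertex (fun h => hmL ((hL m).2 h)) hcoord, ?_⟩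
  have hvol := Toric.factorial_mul_latticeVolume_simplexVertex (l := l) (m := m) hx
  have hprod : ∏ i, m l / b.repr l i = Toric.multiplicity b Finset.univ *
      (𝓛.complements hgen).divisorPow D (Module.finrank ℤ N) ⟨_, hσ⟩ := by
    rw [Finset.prod_div_distrib, Finset.prod_const, Finset.card_univ, Fintype.card_fin,
      div_eq_iff (Finset.prod_ne_zero_iff.2 fun i _ => hcoord i), ← hpow]
  have hset : {i | ((AffineSubspace.mk' m (𝓛.L (Module.finrank ℤ N - 1)) :
        AffineSubspace ℚ (Toric.MQ N)) : Set (Toric.MQ N)) ∩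
      Toric.dualFace (PointedCone.orthant b Finset.univ)
        (PointedCone.orthant b (Finset.univ.erase i)) = ∅} = {i | m l / b.repr l i < 0} :=
    Set.ext fun i => Toric.mk'_inter_dualFace_eq_empty_iff hL (hcoord i)
  have hsign := Finset.prod_eq_neg_one_pow_mul_abs fun i => m l / b.repr l i
  rw [← hvol, hprod] at hsign
  dsimp only
  rw [hset]
  refine mul_left_cancel₀ (Toric.multiplicity_univ_ne_zero hx) ?_
  rw [hsign]
  ring
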